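/- Let $V$ be a countably infinite set and let $b : V\times V\to[0,\infty)$ satisfy $b(x,x)=0$, $b(x,y)=b(y,x)$ and $\deg(x):=\sum_{y\in V} b(x,y)<\infty$ for all $x,y\in V$. Suppose that the graph $(b,0)$ is connected, that is, any two vertices $x,y$ are joined by a finite path $x=x_0,\dots,x_n=y$ with $b(x_{j},x_{j+1})>0$ for all $j<n$. Let $(X_n)_{n\ge 0}$ be a random walk associated with $(b,0)$: a sequence of $V$-valued random variables on a probability space with $$\mathbb P(X_{n+1}=y\mid X_n=x)=\frac{b(x,y)}{\deg(x)},\qquad \mathbb P(X_{n+1}=x_{n+1}\mid X_n=x_n,\dots,X_0=x_0)=\mathbb P(X_{n+1}=x_{n+1}\mid X_n=x_n)$$ for all $n\ge 0$ and all $x,y,x_0,\dots,x_{n+1}\in V$ for which the conditioning events have positive probability. The walk is called recurrent if $\mathbb P(X_n=y \text{ for infinitely many } n\mid X_0=x)=1$ for all $y\in V$ and all $x\in V$ with $\mathbb P(X_0=x)>0$. Let $Q^{D}$ be the regular Dirichlet form of $(b,0)$ on $\ell^2(V,1)$, the real square-summable functions on $V$ with inner product $\langle u,v\rangle=\sum_x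 u(x)v(x)$. It is $$Q^D(u,v)=\tfrac12\sum_{x,y\in V} b(x,y)\,(u(x)-u(y))(v(x)-v(y)),$$ and its domain $D(Q^D)$ is the closure of the finitely supported functions in $\{u\in\ell^2(V,1): Q(u)<\infty\}$ with respect to the norm $(Q(u)+\|u\|_2^2)^{1/2}$, where $Q(u)=\frac12\sum_{x,y}b(x,y)(u(x)-u(y))^2$. Let $L$ be the non-negative self-adjoint operator associated with $Q^D$: $u\in D(L)$ and $Lu=w$ if and only if $u\in D(Q^D)$, $w\in\ell^2(V,1)$ and $Q^D(u,v)=\langle w,v\rangle$ for all $v\in D(Q^D)$. Let $(e^{-tL})_{t>0}$ be the associated strongly continuous Markovian semigroup, and let $\delta_x$ denote the function that is $1$ at $x$ and $0$ elsewhere. The form $Q^D$ is called recurrent if its Green function satisfies $$G(x,y):=\int_0^\infty (e^{-tL}\delta_x)(y)\,dt=\infty\qquad\text{for all } x,y\in V.$$ Then the random walk $(X_n)_{n\ge0}$ is recurrent if and only if $Q^D$ is recurrent. -/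

import Mathlib

open MeasureTheory ProbabilityTheory Filter Topology
open scoped ENNReal

noncomputable section

/-- The real Hilbert space `ℓ²(V, 1)` of square-summable real functions on `V`. -/
abbrev EllTwo (V : Type*) : Type _ := lp (fun _ : V => ℝ) 2

/-- The function `δ_x`, equal to `1` at `x` and to `0` elsewhere, as an element of `ℓ²(V, 1)`. -/
def deltaFun {V : Type*} (x : V) : EllTwo V :=
  letI := Classical.decEq V
  lp.single 2 x (1 : ℝ)

/-- A weighted graph `(b, 0)` over the vertex set `V` (no killing term); infinitely many
neighbours of a vertex are allowed. -/
structure WeightedGraph (V : Type*) where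
  /-- the edge weights -/
  b : V → V → ℝ
  b_nonneg : ∀ x y, 0 ≤ b x y
  b_diag : ∀ x, b x x = 0
  b_symm : ∀ x y, b x y = b y x
  b_summable : ∀ x, Summable (b x)

namespace WeightedGraph

variable {V : Type*} (Γ : WeightedGraph V)

/-- Two vertices are joined by an edge when the weight between them is positive. -/
def Adj (x y : V) : Prop := 0 < Γ.b x y

/-- Any two vertices are joined by a finite path. -/
def Connected : Prop := ∀ x y : V, Relation.ReflTransGen Γ.Adj x y

/-- The (weighted) vertex degree `deg x = ∑ y, b x y`. -/
def deg (x : V) : ℝ := ∑' y, Γ.b x y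

/-! ### The energy form and the regular Dirichlet form -/

/-- The quadratic form `½ ∑ b(x,y) (u x - u y)²`, with values in `[0, ∞]`, on all functions. -/
def energy (u : V → ℝ) : ℝ≥0∞ :=
  (∑' p : V × V, ENNReal.ofReal (Γ.b p.1 p.2 * (u p.1 - u p.2) ^ 2)) / 2

/-- The bilinear form `½ ∑ b(x,y) (u x - u y) (v x - v y)`. The sum converges absolutely when `u`
and `v` have finite energy, and it is only used for such functions. -/
def form (u v : V → ℝ) : ℝ :=
  (∑' p : V × V, Γ.b p.1 p.2 * (u p.1 - u p.2) * (v p.1 - v p.2)) / 2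

/-- The square of the form norm on `ℓ²(V, 1)`: energy plus the square of the `ℓ²` norm. -/
def formNormSq (u : EllTwo V) : ℝ≥0∞ := Γ.energy u + ‖u‖ₑ ^ 2

/-- The domain of the regular Dirichlet form `Q^D` on `ℓ²(V, 1)`: the closure of the finitely
supported functions, in the square-summable functions of finite energy, for the form norm.
The form `Q^D` is the restriction of `form` to this domain. -/
def domQD : Set (EllTwo V) :=
  {u | Γ.energy u < ∞ ∧
    ∀ ε : ℝ≥0∞, 0 < ε → ∃ v : EllTwo V, (Function.support v).Finite ∧ Γ.formNormSq (u - v) < ε}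

/-- `Γ.IsLD u w` says that `u` is in the domain of the operator `L^D` associated with `Q^D`, and
`L^D u = w`: that is, `u` is in the domain of `Q^D`, and `Q^D(u, v) = ⟨w, v⟩` for all `v` in it. -/
def IsLD (u w : EllTwo V) : Prop :=
  u ∈ Γ.domQD ∧ ∀ v ∈ Γ.domQD, Γ.form u v = inner ℝ w v

/-- `T` is the semigroup `T t = e^{-t L^D}`, `t > 0`, on `ℓ²(V, 1)` associated with `Q^D`: the
strongly continuous Markovian semigroup of symmetric contractions whose generator is `L^D`, in the
sense that `L^D u = lim (u - T t u) / t` as `t` tends to `0`, where `u` is in the domain of `L^D`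
exactly when this limit exists. These properties determine `T t` for all `t > 0`. -/
structure IsSemigroupQD (T : ℝ → EllTwo V →L[ℝ] EllTwo V) : Prop where
  symmetric : ∀ t, 0 < t → IsSelfAdjoint (T t)
  semigroup : ∀ t s, 0 < t → 0 < s → T (t + s) = (T t).comp (T s)
  contractive : ∀ t, 0 < t → ∀ f, ‖T t f‖ ≤ ‖f‖
  strongly_continuous : ∀ f, Tendsto (fun t => T t f) (𝓝[>] 0) (𝓝 f)
  markov : ∀ t, 0 < t → ∀ f : EllTwo V, (∀ x, 0 ≤ f x ∧ f x ≤ 1) →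
    ∀ x, 0 ≤ T t f x ∧ T t f x ≤ 1
  generator : ∀ u w, Γ.IsLD u w ↔
    Tendsto (fun t : ℝ => t⁻¹ • (u - T t u)) (𝓝[>] 0) (𝓝 w)

/-- The Green function `G(x, y) = ∫₀^∞ (T t δ_x)(y) dt` in `[0, ∞]` of a family of operators whose
integrands `(T t δ_x)(y)` are non-negative. -/
def green (T : ℝ → EllTwo V →L[ℝ] EllTwo V) (x y : V) : ℝ≥0∞ :=
  ∫⁻ t in Set.Ioi (0 : ℝ), ENNReal.ofReal (T t (deltaFun x) y)

/-- `Q^D` on `ℓ²(V, 1)` is recurrent: its semigroup has Green function `∞` everywhere. -/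
def IsRecurrentQD : Prop :=
  ∃ T : ℝ → EllTwo V →L[ℝ] EllTwo V, Γ.IsSemigroupQD T ∧ ∀ x y, green T x y = ∞

/-! ### The random walk -/

/-- `X` is a random walk associated with `(b, 0)`, with an arbitrary initial distribution. The
conditions on conditional probabilities are imposed whenever the conditioning event has positive
probability. -/
structure IsRandomWalk [MeasurableSpace V] {Ω : Type*} [MeasurableSpace Ω]
    (P : Measure Ω) (X : ℕ → Ω → V) : Prop where
  measurable : ∀ n, Measurable (X n)
  transition : ∀ (n : ℕ) (x y : V), P {ω | X n ω = x} ≠ 0 →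
    P[{ω | X (n + 1) ω = y} | {ω | X n ω = x}] = ENNReal.ofReal (Γ.b x y / Γ.deg x)
  markov : ∀ (n : ℕ) (x : ℕ → V), P {ω | ∀ k ≤ n, X k ω = x k} ≠ 0 →
    P[{ω | X (n + 1) ω = x (n + 1)} | {ω | ∀ k ≤ n, X k ω = x k}] =
      P[{ω | X (n + 1) ω = x (n + 1)} | {ω | X n ω = x n}]

end WeightedGraph

/-- A process with values in `V` is recurrent: from every possible starting point `x`, it visits
every `y` infinitely often almost surely. -/
def IsRecurrentProcess {V : Type*} {Ω : Type*} [MeasurableSpace Ω]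
    (P : Measure Ω) (X : ℕ → Ω → V) : Prop :=
  ∀ x y : V, P {ω | X 0 ω = x} ≠ 0 →
    P[{ω | ∃ᶠ n in atTop, X n ω = y} | {ω | X 0 ω = x}] = 1

end

/-! Both notions of recurrence say that one and the same series diverges: the Neumann series of the
equation `deg y * G y = 1_{y = x} + ∑ z, b y z * G z`, whose partial sums are `greenIter`.

On the side of the walk, the symmetry of `b` turns the expected number of visits to `y` from `x`
into `deg y` times this series (`tsum_measure_eq`). Borel–Cantelli shows that visiting `y`
infinitely often forces the expectation to be infinite. Conversely, decomposing by the last visit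
bounds the expectation times the escape probability from `y` by `1`; if the expectation is infinite,
return to `y` is certain, and connectedness makes `y` certain to be hit from every vertex
(`iInf_avoidProb_self`, `iInf_avoidProb_eq_zero`).

On the side of the form, `green_eq` identifies the Green function with the series. It is the
increasing limit of `(α + L)⁻¹ δ_x` as `α` decreases to `0`. The resolvent equation makes it
superharmonic, hence at least every partial sum. For the upper bound, density of the finitely
supported functions in the form domain makes the resolvent a limit of solutions on finite sets
(`exists_galerkin`), where iterating the equation leaves a geometrically small remainder.

The semigroup itself is built from the form by the Hille–Yosida construction. Since the walk may
charge only one starting vertex, symmetry and connectedness are needed to spread an infinite Green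
value to all pairs. -/

/-! ### Contraction semigroups from resolvents -/

section Semigroup

variable {H : Type*} [NormedAddCommGroup H] [InnerProductSpace ℝ H] [CompleteSpace H]

open NormedSpace in
/-- The exponential of a multiple of `J - 1` is a Poisson average of the powers of `J`. -/
theorem hasSum_poisson_exp (J : H →L[ℝ] H) (r t : ℝ) (f : H) :
    HasSum (fun n : ℕ => (Real.exp (-(t * r)) * ((t * r) ^ n / n.factorial)) • (J ^ n) f)
      (exp (t • (r • (J - 1))) f) := by
  let _ : NormedAlgebra ℚ (H →L[ℝ] H) := NormedAlgebra.restrictScalars ℚ ℝ _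
  have h1 : t • (r • (J - 1)) = (-(t * r)) • (1 : H →L[ℝ] H) + (t * r) • J := by
    rw [smul_smul, smul_sub, neg_smul]; abel
  have h2 : exp ((-(t * r)) • (1 : H →L[ℝ] H)) = Real.exp (-(t * r)) • (1 : H →L[ℝ] H) := by
    rw [← Algebra.algebraMap_eq_smul_one, ← algebraMap_exp_comm, ← Real.exp_eq_exp_ℝ,
      Algebra.algebraMap_eq_smul_one]
  have hc : Commute ((-(t * r)) • (1 : H →L[ℝ] H)) ((t * r) • J) :=
    ((Commute.one_left J).smul_left _).smul_right _
  rw [h1, exp_add_of_commute hc, h2, smul_mul_assoc, one_mul]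
  have h3 := exp_series_hasSum_exp' (𝕂 := ℝ) ((t * r) • J)
  have h4 := (h3.mapL (ContinuousLinearMap.apply ℝ H f)).const_smul (Real.exp (-(t * r)))
  convert h4 using 2 with n
  · simp only [ContinuousLinearMap.apply_apply, _root_.smul_apply, smul_pow, smul_smul]
    congr 1
    ring
  · rfl

theorem hasSum_poisson_weights (s : ℝ) :
    HasSum (fun n : ℕ => Real.exp (-s) * (s ^ n / n.factorial)) 1 := by
  have := (NormedSpace.expSeries_div_hasSum_exp (𝔸 := ℝ) s).mul_left (Real.exp (-s))
  rwa [← Real.exp_eq_exp_ℝ, ← Real.exp_add, neg_add_cancel, Real.exp_zero] at this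

/-- A Poisson average of powers of a contraction is a contraction. -/
theorem norm_exp_smul_sub_one_apply_le {J : H →L[ℝ] H} (hJ : ‖J‖ ≤ 1) {r t : ℝ} (hr : 0 ≤ r)
    (ht : 0 ≤ t) (f : H) : ‖NormedSpace.exp (t • (r • (J - 1))) f‖ ≤ ‖f‖ := by
  have h1 := hasSum_poisson_exp J r t f
  have h2 := (hasSum_poisson_weights (t * r)).mul_right ‖f‖
  rw [one_mul] at h2
  rw [← h1.tsum_eq]
  refine tsum_of_norm_bounded h2 fun n => ?_
  have h0 : 0 ≤ Real.exp (-(t * r)) * ((t * r) ^ n / n.factorial) := by positivity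
  rw [norm_smul, Real.norm_of_nonneg h0]
  refine mul_le_mul_of_nonneg_left ?_ h0
  calc ‖(J ^ n) f‖ ≤ ‖J ^ n‖ * ‖f‖ := (J ^ n).le_opNorm f
    _ ≤ 1 * ‖f‖ := by
      gcongr
      rcases Nat.eq_zero_or_pos n with rfl | hn
      · exact (pow_zero J).symm ▸ ContinuousLinearMap.norm_id_le (𝕜 := ℝ) (E := H)
      · exact (norm_pow_le' J hn).trans (pow_le_one₀ (norm_nonneg _) hJ)
    _ = ‖f‖ := one_mul _

/-- A functional with values in `[0, 1]` on the orbit of `f` under `J` has values in `[0, 1]` on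
the orbit of `f` under the semigroup generated by `J - 1`. -/
theorem exp_smul_sub_one_apply_mem_Icc {J : H →L[ℝ] H} {r t : ℝ} (hr : 0 ≤ r) (ht : 0 ≤ t)
    (φ : H →L[ℝ] ℝ) (f : H) (hf : ∀ n : ℕ, φ ((J ^ n) f) ∈ Set.Icc (0 : ℝ) 1) :
    φ (NormedSpace.exp (t • (r • (J - 1))) f) ∈ Set.Icc (0 : ℝ) 1 := by
  have h1 := (hasSum_poisson_exp J r t f).mapL φ
  have h2 := hasSum_poisson_weights (t * r)
  have h0 : ∀ n : ℕ, 0 ≤ Real.exp (-(t * r)) * ((t * r) ^ n / n.factorial) := fun n => by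
    positivity
  simp only [map_smul, smul_eq_mul] at h1
  exact ⟨h1.nonneg fun n => mul_nonneg (h0 n) (hf n).1,
    hasSum_le (fun n => mul_le_of_le_one_right (h0 n) (hf n).2) h1 h2⟩

/-- First order expansion at `0` of a contraction semigroup. -/
theorem norm_exp_smul_apply_sub_add_le (B : H →L[ℝ] H) {t K : ℝ} (ht : 0 ≤ t) (f h : H)
    (hK : ∀ s : ℝ, 0 ≤ s → s ≤ t → ‖NormedSpace.exp (s • B) (B f) + h‖ ≤ K) :
    ‖NormedSpace.exp (t • B) f - f + t • h‖ ≤ K * t := by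
  have hd : ∀ s : ℝ, HasDerivAt (fun s : ℝ => NormedSpace.exp (s • B) f + s • h)
      (NormedSpace.exp (s • B) (B f) + h) s := by
    intro s
    have h3 := ((hasDerivAt_exp_smul_const B s).clm_apply (hasDerivAt_const s f)).add
      ((hasDerivAt_id s).smul_const h)
    exact h3.congr_deriv (by simp)
  have h := norm_image_sub_le_of_norm_deriv_le_segment' (a := 0) (b := t)
    (C := K) (fun s _ => (hd s).hasDerivWithinAt)
    (fun s hs => hK s hs.1 hs.2.le) t (Set.right_mem_Icc.2 ht)
  simpa [NormedSpace.exp_zero, add_sub_right_comm] using h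

theorem norm_exp_smul_apply_sub_le {B : H →L[ℝ] H}
    (hB : ∀ t : ℝ, 0 ≤ t → ∀ f, ‖NormedSpace.exp (t • B) f‖ ≤ ‖f‖) {t : ℝ} (ht : 0 ≤ t) (f : H) :
    ‖NormedSpace.exp (t • B) f - f‖ ≤ ‖B f‖ * t := by
  simpa using norm_exp_smul_apply_sub_add_le B ht f 0
    (fun s hs _ => by simpa using hB s hs (B f))

/-- Two commuting generators of contraction semigroups. -/
theorem norm_exp_smul_sub_exp_smul_le {B C : H →L[ℝ] H} (hBC : Commute B C)
    (hB : ∀ t : ℝ, 0 ≤ t → ∀ f, ‖NormedSpace.exp (t • B) f‖ ≤ ‖f‖)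
    (hC : ∀ t : ℝ, 0 ≤ t → ∀ f, ‖NormedSpace.exp (t • C) f‖ ≤ ‖f‖) {t : ℝ} (ht : 0 ≤ t) (f : H) :
    ‖NormedSpace.exp (t • B) f - NormedSpace.exp (t • C) f‖ ≤ t * ‖B f - C f‖ := by
  have hd : ∀ s : ℝ, HasDerivAt (fun s : ℝ => NormedSpace.exp (s • B)
      (NormedSpace.exp ((t - s) • C) f))
      (NormedSpace.exp (s • B) (NormedSpace.exp ((t - s) • C) (B f - C f))) s := by
    intro s
    have h1 := hasDerivAt_exp_smul_const B s
    have h2 := (hasDerivAt_exp_smul_const C (t - s)).scomp s ((hasDerivAt_id s).const_sub t)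
    have h3 := h1.clm_apply (h2.clm_apply (hasDerivAt_const s f))
    have h4 : B (NormedSpace.exp ((t - s) • C) f) = NormedSpace.exp ((t - s) • C) (B f) :=
      congrArg (fun S : H →L[ℝ] H => S f) ((hBC.symm.smul_left (t - s)).exp_left).eq.symm
    refine h3.congr_deriv ?_
    simp [h4, ← sub_eq_add_neg]
  have h := norm_image_sub_le_of_norm_deriv_le_segment' (a := 0) (b := t)
    (C := ‖B f - C f‖) (fun s _ => (hd s).hasDerivWithinAt)
    (fun s hs => (hB s hs.1 _).trans (hC _ (sub_nonneg.2 hs.2.le) _)) t (Set.right_mem_Icc.2 ht)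
  simpa [mul_comm] using h

omit [CompleteSpace H] in
/-- Convergence to `0` of uniformly bounded operators may be tested on a dense set. -/
theorem tendsto_zero_of_dense {ι : Type*} {l : Filter ι} {R : ι → H →L[ℝ] H} {D : Set H}
    (hD : Dense D) (hR : ∀ᶠ i in l, ∀ f, ‖R i f‖ ≤ 2 * ‖f‖)
    (h : ∀ u ∈ D, Tendsto (fun i => R i u) l (𝓝 0)) (f : H) :
    Tendsto (fun i => R i f) l (𝓝 0) := by
  rw [Metric.tendsto_nhds]
  intro ε hε
  obtain ⟨u, hu, huf⟩ := hD.exists_dist_lt f (show 0 < ε / 4 by positivity)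
  filter_upwards [hR, (Metric.tendsto_nhds.1 (h u hu)) (ε / 2) (by positivity)] with i h1 h2
  rw [dist_zero_right] at h2 ⊢
  rw [dist_eq_norm] at huf
  calc ‖R i f‖ = ‖R i (f - u) + R i u‖ := by rw [map_sub, sub_add_cancel]
    _ ≤ 2 * ‖f - u‖ + ‖R i u‖ := (norm_add_le _ _).trans (by gcongr; exact h1 _)
    _ < ε := by linarith

/-! ### Hille–Yosida: from resolvents to the semigroup -/

/-- `J c`, `c > 0`, are the resolvents `(1 + c L)⁻¹` of a densely defined non-negative self-adjoint
operator `L` with graph `A`. -/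
structure IsResolventFamily (J : ℝ → H →L[ℝ] H) (A : H → H → Prop) : Prop where
  norm_le : ∀ c, 0 < c → ‖J c‖ ≤ 1
  selfAdjoint : ∀ c, 0 < c → IsSelfAdjoint (J c)
  graph_iff : ∀ c, 0 < c → ∀ u w, A u w ↔ J c (u + c • w) = u
  dense : Dense {u | ∃ w, A u w}

/-- The bounded operator `c⁻¹ (J c - 1)`. -/
noncomputable def yosidaGen (J : ℝ → H →L[ℝ] H) (c : ℝ) : H →L[ℝ] H := c⁻¹ • (J c - 1)

namespace IsResolventFamily

variable {J : ℝ → H →L[ℝ] H} {A : H → H → Prop} (h : IsResolventFamily J A)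

theorem graph_apply (h : IsResolventFamily J A) {c : ℝ} (hc : 0 < c) (f : H) :
    A (J c f) (c⁻¹ • (f - J c f)) := by
  rw [h.graph_iff c hc, smul_inv_smul₀ hc.ne', add_sub_cancel]

/-- On the domain, the bounded approximation is `-L` smoothed by the resolvent; it therefore
converges to `-L` as `c` tends to `0`. -/
theorem yosidaGen_apply (h : IsResolventFamily J A) {c : ℝ} (hc : 0 < c) {u w : H} (hu : A u w) :
    yosidaGen J c u = -J c w := by
  have h1 := (h.graph_iff c hc u w).1 hu
  rw [map_add, map_smul] at h1
  have h2 : J c u - u = -(c • J c w) := by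
    rw [← sub_eq_zero, sub_neg_eq_add, sub_add_eq_add_sub, h1, sub_self]
  simp only [yosidaGen, _root_.smul_apply, _root_.sub_apply, one_apply_eq_self, h2,
    smul_neg, inv_smul_smul₀ hc.ne']

theorem norm_apply_le (h : IsResolventFamily J A) {c : ℝ} (hc : 0 < c) (f : H) :
    ‖J c f‖ ≤ ‖f‖ := by
  simpa using (J c).le_of_opNorm_le (h.norm_le c hc) f

theorem commute (h : IsResolventFamily J A) {c d : ℝ} (hc : 0 < c) (hd : 0 < d) :
    Commute (J c) (J d) := by
  rcases eq_or_ne c d with rfl | hcd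
  · exact Commute.refl _
  -- The resolvent identity: the right-hand side is self-adjoint, so taking adjoints swaps the two
  -- factors on the left.
  have h1 : (1 - c / d) • (J c * J d) = J d - (c / d) • J c := by
    ext f
    have h2 := (h.graph_iff c hc _ _).1 (h.graph_apply hd f)
    rw [smul_smul, smul_sub, map_add, map_sub, map_smul, map_smul, ← div_eq_mul_inv] at h2
    simp only [_root_.smul_apply, _root_.sub_apply, sub_smul, one_smul]
    change J c (J d f) - (c / d) • J c (J d f) = _
    linear_combination (norm := module) h2
  have h3 := congrArg star h1
  simp only [star_smul, star_mul, star_sub, (h.selfAdjoint c hc).star_eq,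
    (h.selfAdjoint d hd).star_eq, star_trivial] at h3
  rw [← h1] at h3
  have h4 : (1 - c / d) ≠ 0 := by
    rw [sub_ne_zero, ne_comm, Ne, div_eq_one_iff_eq hd.ne']
    exact hcd
  exact (smul_right_injective _ h4 h3).symm

theorem norm_exp_yosidaGen_apply_le (h : IsResolventFamily J A) {c : ℝ} (hc : 0 < c) (t : ℝ)
    (ht : 0 ≤ t) (f : H) : ‖NormedSpace.exp (t • yosidaGen J c) f‖ ≤ ‖f‖ :=
  norm_exp_smul_sub_one_apply_le (h.norm_le c hc) (inv_nonneg.2 hc.le) ht f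

theorem tendsto_apply (h : IsResolventFamily J A) (f : H) :
    Tendsto (fun n : ℕ => J (1 / ((n : ℝ) + 1)) f) atTop (𝓝 f) := by
  have h0 : ∀ n : ℕ, 0 < 1 / ((n : ℝ) + 1) := fun n => Nat.one_div_pos_of_nat
  suffices Tendsto (fun n : ℕ => (J (1 / ((n : ℝ) + 1)) - 1) f) atTop (𝓝 0) by
    simpa using this.add_const f
  refine tendsto_zero_of_dense h.dense (.of_forall fun n g => ?_) ?_ f
  · calc ‖(J (1 / ((n : ℝ) + 1)) - 1) g‖ ≤ ‖J (1 / ((n : ℝ) + 1)) g‖ + ‖g‖ := norm_sub_le _ _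
      _ ≤ 2 * ‖g‖ := by linarith [h.norm_apply_le (h0 n) g]
  · rintro u ⟨w, hu⟩
    have h1 := (tendsto_one_div_add_atTop_nhds_zero_nat (𝕜 := ℝ)).mul_const ‖w‖
    rw [zero_mul] at h1
    refine squeeze_zero_norm (fun n => ?_) h1
    have h2 := h.yosidaGen_apply (h0 n) hu
    rw [yosidaGen, _root_.smul_apply, inv_smul_eq_iff₀ (h0 n).ne'] at h2
    rw [h2, norm_smul, norm_neg, Real.norm_of_nonneg (h0 n).le]
    exact mul_le_mul_of_nonneg_left (h.norm_apply_le (h0 n) w) (h0 n).le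

theorem isSelfAdjoint_exp (h : IsResolventFamily J A) {c : ℝ} (hc : 0 < c) (t : ℝ) :
    IsSelfAdjoint (NormedSpace.exp (t • yosidaGen J c)) := by
  have h1 : IsSelfAdjoint (J c - 1) := (h.selfAdjoint _ hc).sub (IsSelfAdjoint.one _)
  have h2 : IsSelfAdjoint (yosidaGen J c) := IsSelfAdjoint.smul (.all c⁻¹) h1
  exact (IsSelfAdjoint.smul (.all t) h2).exp

/-- For `u` in the domain with `L u = w`, two approximating semigroups differ at `u` by at most `t`
times the difference of two resolvents at `w`. Uniform contractivity extends this to all vectors. -/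
theorem cauchySeq_exp (h : IsResolventFamily J A) {t : ℝ} (ht : 0 ≤ t) (f : H) :
    CauchySeq fun n : ℕ => NormedSpace.exp (t • yosidaGen J (1 / ((n : ℝ) + 1))) f := by
  have h0 : ∀ n : ℕ, 0 < 1 / ((n : ℝ) + 1) := fun n => Nat.one_div_pos_of_nat
  rw [cauchySeq_iff_tendsto_dist_atTop_0]
  suffices Tendsto (fun p : ℕ × ℕ => (NormedSpace.exp (t • yosidaGen J (1 / ((p.1 : ℝ) + 1))) -
      NormedSpace.exp (t • yosidaGen J (1 / ((p.2 : ℝ) + 1)))) f) atTop (𝓝 0) by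
    simpa [dist_eq_norm] using this.norm
  refine tendsto_zero_of_dense h.dense (.of_forall fun p g => ?_) ?_ f
  · refine (norm_sub_le _ _).trans ?_
    rw [two_mul]
    exact add_le_add (h.norm_exp_yosidaGen_apply_le (h0 p.1) t ht g)
      (h.norm_exp_yosidaGen_apply_le (h0 p.2) t ht g)
  · rintro u ⟨w, hu⟩
    have h1 := ((cauchySeq_iff_tendsto_dist_atTop_0.1
      (h.tendsto_apply w).cauchySeq).const_mul t)
    rw [mul_zero] at h1
    refine squeeze_zero_norm (fun p => ?_) h1
    have hcomm : Commute (yosidaGen J (1 / ((p.1 : ℝ) + 1))) (yosidaGen J (1 / ((p.2 : ℝ) + 1))) :=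
      ((((h.commute (h0 p.1) (h0 p.2)).sub_left (Commute.one_left _)).sub_right
        (Commute.one_right _)).smul_left _).smul_right _
    refine (norm_exp_smul_sub_exp_smul_le hcomm (h.norm_exp_yosidaGen_apply_le (h0 p.1))
      (h.norm_exp_yosidaGen_apply_le (h0 p.2)) ht u).trans_eq ?_
    rw [h.yosidaGen_apply (h0 p.1) hu, h.yosidaGen_apply (h0 p.2) hu, dist_eq_norm,
      neg_sub_neg, norm_sub_rev]

/-- The strong limits of the Yosida approximations. -/
theorem exists_limit (h : IsResolventFamily J A) : ∃ T : ℝ → H →L[ℝ] H, ∀ t, 0 ≤ t → ∀ f,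
    Tendsto (fun n : ℕ => NormedSpace.exp (t • yosidaGen J (1 / ((n : ℝ) + 1))) f) atTop
      (𝓝 (T t f)) := by
  have h0 : ∀ n : ℕ, 0 < 1 / ((n : ℝ) + 1) := fun n => Nat.one_div_pos_of_nat
  have key : ∀ t : ℝ, ∃ S : H →L[ℝ] H, 0 ≤ t → ∀ f,
      Tendsto (fun n : ℕ => NormedSpace.exp (t • yosidaGen J (1 / ((n : ℝ) + 1))) f) atTop
        (𝓝 (S f)) := by
    intro t
    by_cases ht : 0 ≤ t
    · choose S hS using fun f => cauchySeq_tendsto_of_complete (h.cauchySeq_exp ht f)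
      let S' : H →ₗ[ℝ] H :=
        { toFun := S
          map_add' := fun f g => tendsto_nhds_unique (hS (f + g)) (by
            simpa only [map_add] using (hS f).add (hS g))
          map_smul' := fun a f => tendsto_nhds_unique (hS (a • f)) (by
            simpa only [map_smul, RingHom.id_apply] using (hS f).const_smul a) }
      refine ⟨S'.mkContinuous 1 fun f => ?_, fun _ f => hS f⟩
      rw [one_mul]
      exact le_of_tendsto' (hS f).norm fun n => h.norm_exp_yosidaGen_apply_le (h0 n) t ht f
    · exact ⟨0, fun h' => absurd h' ht⟩
  choose T hT using key
  exact ⟨T, hT⟩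

end IsResolventFamily

/-- `T t` is the strong limit of the exponentials of the Yosida approximations. -/
def IsYosidaLimit (J : ℝ → H →L[ℝ] H) (T : ℝ → H →L[ℝ] H) : Prop :=
  ∀ t, 0 ≤ t → ∀ f,
    Tendsto (fun n : ℕ => NormedSpace.exp (t • yosidaGen J (1 / ((n : ℝ) + 1))) f) atTop
      (𝓝 (T t f))

namespace IsYosidaLimit

variable {J : ℝ → H →L[ℝ] H} {A : H → H → Prop} {T : ℝ → H →L[ℝ] H}

theorem norm_apply_le (hT : IsYosidaLimit J T) (h : IsResolventFamily J A) {t : ℝ} (ht : 0 ≤ t)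
    (f : H) : ‖T t f‖ ≤ ‖f‖ :=
  le_of_tendsto' (hT t ht f).norm fun _ =>
    h.norm_exp_yosidaGen_apply_le Nat.one_div_pos_of_nat t ht f

theorem isSelfAdjoint (hT : IsYosidaLimit J T) (h : IsResolventFamily J A) {t : ℝ} (ht : 0 ≤ t) :
    IsSelfAdjoint (T t) := by
  rw [ContinuousLinearMap.isSelfAdjoint_iff_isSymmetric]
  intro f g
  refine tendsto_nhds_unique ((hT t ht f).inner (𝕜 := ℝ) (tendsto_const_nhds (x := g))) ?_
  refine ((tendsto_const_nhds (x := f)).inner (𝕜 := ℝ) (hT t ht g)).congr fun n => ?_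
  have h0 : (0 : ℝ) < 1 / ((n : ℝ) + 1) := Nat.one_div_pos_of_nat
  have h1 := ContinuousLinearMap.isSelfAdjoint_iff_isSymmetric.1 (h.isSelfAdjoint_exp h0 t)
  exact (h1 f g).symm

theorem apply_add (hT : IsYosidaLimit J T) (h : IsResolventFamily J A) {t s : ℝ} (ht : 0 ≤ t)
    (hs : 0 ≤ s) : T (t + s) = (T t).comp (T s) := by
  let _ : NormedAlgebra ℚ (H →L[ℝ] H) := NormedAlgebra.restrictScalars ℚ ℝ _
  ext f
  refine tendsto_nhds_unique (hT (t + s) (add_nonneg ht hs) f) ?_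
  have h1 : Tendsto (fun n : ℕ => NormedSpace.exp (t • yosidaGen J (1 / ((n : ℝ) + 1)))
      (NormedSpace.exp (s • yosidaGen J (1 / ((n : ℝ) + 1))) f - T s f)) atTop (𝓝 0) := by
    refine squeeze_zero_norm
      (fun n => h.norm_exp_yosidaGen_apply_le Nat.one_div_pos_of_nat t ht _) ?_
    simpa using ((hT s hs f).sub_const (T s f)).norm
  have h2 := h1.add (hT t ht (T s f))
  rw [zero_add] at h2
  refine h2.congr fun n => ?_
  have hc : Commute (t • yosidaGen J (1 / ((n : ℝ) + 1))) (s • yosidaGen J (1 / ((n : ℝ) + 1))) :=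
    ((Commute.refl _).smul_left _).smul_right _
  rw [map_sub, sub_add_cancel, add_smul, NormedSpace.exp_add_of_commute hc,
    mul_apply_eq_comp]

/-- A quantitative derivative at `0`. The value `w = L u` need not lie in the domain, so it is
approximated by a domain element `u'`, on which the semigroup moves by at most `t * ‖w'‖`. -/
theorem norm_apply_sub_add_le (hT : IsYosidaLimit J T) (h : IsResolventFamily J A) {t : ℝ}
    (ht : 0 ≤ t) {u w u' w' : H} (hu : A u w) (hu' : A u' w') :
    ‖T t u - u + t • w‖ ≤ (2 * ‖w - u'‖ + t * ‖w'‖) * t := by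
  have h1 : Tendsto (fun n : ℕ => (‖w - J (1 / ((n : ℝ) + 1)) w‖ + (2 * ‖w - u'‖ + t * ‖w'‖)) * t)
      atTop (𝓝 ((0 + (2 * ‖w - u'‖ + t * ‖w'‖)) * t)) := by
    refine (Tendsto.add_const _ ?_).mul_const _
    simpa using ((tendsto_const_nhds (x := w)).sub (h.tendsto_apply w)).norm
  rw [zero_add] at h1
  refine le_of_tendsto_of_tendsto' (((hT t ht u).sub_const u).add_const (t • w)).norm h1
    fun n => ?_
  have h0 : (0 : ℝ) < 1 / ((n : ℝ) + 1) := Nat.one_div_pos_of_nat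
  refine norm_exp_smul_apply_sub_add_le _ ht u w fun s hs hst => ?_
  set E := NormedSpace.exp (s • yosidaGen J (1 / ((n : ℝ) + 1)))
  have hE : ∀ f, ‖E f‖ ≤ ‖f‖ := h.norm_exp_yosidaGen_apply_le h0 s hs
  have h3 : ‖E u' - u'‖ ≤ t * ‖w'‖ := by
    refine (norm_exp_smul_apply_sub_le (h.norm_exp_yosidaGen_apply_le h0) hs u').trans ?_
    rw [h.yosidaGen_apply h0 hu', norm_neg, mul_comm]
    exact mul_le_mul hst (h.norm_apply_le h0 w') (norm_nonneg _) ht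
  have h4 : E (-J (1 / ((n : ℝ) + 1)) w) + w =
      E (w - J (1 / ((n : ℝ) + 1)) w) + (-E (w - u') + ((w - u') - (E u' - u'))) := by
    simp only [map_sub, map_neg]
    abel
  rw [h.yosidaGen_apply h0 hu, h4]
  refine (norm_add_le _ _).trans (add_le_add (hE _) ((norm_add_le _ _).trans ?_))
  rw [norm_neg]
  linarith [hE (w - u'), norm_sub_le (w - u') (E u' - u')]

theorem tendsto_zero (hT : IsYosidaLimit J T) (h : IsResolventFamily J A) (f : H) :
    Tendsto (fun t => T t f) (𝓝[>] 0) (𝓝 f) := by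
  suffices Tendsto (fun t : ℝ => (T t - 1) f) (𝓝[>] 0) (𝓝 0) by
    simpa using this.add_const f
  refine tendsto_zero_of_dense h.dense ?_ ?_ f
  · filter_upwards [self_mem_nhdsWithin] with t ht g
    calc ‖(T t - 1) g‖ ≤ ‖T t g‖ + ‖g‖ := norm_sub_le _ _
      _ ≤ 2 * ‖g‖ := by linarith [hT.norm_apply_le h (le_of_lt ht) g]
  · rintro u ⟨w, hu⟩
    have h1 : Tendsto (fun t : ℝ => (2 * ‖w - u‖ + t * ‖w‖) * t + t * ‖w‖) (𝓝[>] 0) (𝓝 0) := by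
      refine tendsto_nhdsWithin_of_tendsto_nhds (Continuous.tendsto' (by fun_prop) _ _ (by simp))
    refine squeeze_zero_norm' ?_ h1
    filter_upwards [self_mem_nhdsWithin] with t ht
    have ht' : 0 ≤ t := le_of_lt ht
    calc ‖(T t - 1) u‖ = ‖(T t u - u + t • w) - t • w‖ := by rw [add_sub_cancel_right]; rfl
      _ ≤ _ := (norm_sub_le _ _).trans (add_le_add (hT.norm_apply_sub_add_le h ht' hu hu)
        (by rw [norm_smul, Real.norm_of_nonneg ht']))

theorem tendsto_generator (hT : IsYosidaLimit J T) (h : IsResolventFamily J A) {u w : H}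
    (hu : A u w) : Tendsto (fun t : ℝ => t⁻¹ • (u - T t u)) (𝓝[>] 0) (𝓝 w) := by
  rw [Metric.tendsto_nhds]
  intro ε hε
  obtain ⟨u', ⟨w', hu'⟩, hw⟩ := h.dense.exists_dist_lt w (show 0 < ε / 4 by positivity)
  have h1 : Tendsto (fun t : ℝ => t * ‖w'‖) (𝓝[>] 0) (𝓝 0) :=
    tendsto_nhdsWithin_of_tendsto_nhds (Continuous.tendsto' (by fun_prop) _ _ (by simp))
  filter_upwards [self_mem_nhdsWithin, h1.eventually (gt_mem_nhds (half_pos hε))] with t ht ht2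
  have ht0 : 0 < t := ht
  rw [dist_eq_norm] at hw ⊢
  have h2 : t⁻¹ • (u - T t u) - w = -(t⁻¹ • (T t u - u + t • w)) := by
    rw [smul_add, inv_smul_smul₀ ht0.ne', neg_add, ← smul_neg, neg_sub, sub_eq_add_neg]
  rw [h2, norm_neg, norm_smul, norm_inv, Real.norm_of_nonneg ht0.le, inv_mul_lt_iff₀ ht0, mul_comm]
  refine (hT.norm_apply_sub_add_le h ht0.le hu hu').trans_lt ?_
  exact mul_lt_mul_of_pos_right (by linarith) ht0

/-- The generator cannot properly extend `L`. As `1 + L` is onto, some `v` in the domain solves `v +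
L v = u + w`; the generator then sends `v - u` to `-(v - u)`, and it is non-negative by
contractivity, so `v = u`. -/
theorem generator_iff (hT : IsYosidaLimit J T) (h : IsResolventFamily J A) (u w : H) :
    A u w ↔ Tendsto (fun t : ℝ => t⁻¹ • (u - T t u)) (𝓝[>] 0) (𝓝 w) := by
  refine ⟨hT.tendsto_generator h, fun hu => ?_⟩
  have hv := h.graph_apply one_pos (u + w)
  set v := J 1 (u + w)
  rw [inv_one, one_smul] at hv
  have h1 := (hT.tendsto_generator h hv).sub hu
  have h2 : Tendsto (fun t : ℝ => t⁻¹ • ((v - u) - T t (v - u))) (𝓝[>] 0) (𝓝 (-(v - u))) := by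
    refine (h1.congr fun t => ?_).trans_eq ?_
    · rw [← smul_sub, map_sub]
      congr 1
      abel
    · congr 1
      abel
  have h3 := h2.inner (𝕜 := ℝ) (tendsto_const_nhds (x := v - u))
  have h4 : (0 : ℝ) ≤ inner ℝ (-(v - u)) (v - u) := by
    refine ge_of_tendsto h3 ?_
    filter_upwards [self_mem_nhdsWithin] with t ht
    have ht0 : 0 < t := ht
    rw [real_inner_smul_left, inner_sub_left, real_inner_self_eq_norm_sq]
    refine mul_nonneg (inv_nonneg.2 ht0.le) (sub_nonneg.2 ?_)
    refine (real_inner_le_norm _ _).trans ?_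
    rw [sq]
    exact mul_le_mul_of_nonneg_right (hT.norm_apply_le h ht0.le _) (norm_nonneg _)
  rw [inner_neg_left, real_inner_self_eq_norm_sq] at h4
  have h5 : v = u := by
    rw [← sub_eq_zero, ← norm_eq_zero]
    exact pow_eq_zero_iff two_ne_zero |>.1 (le_antisymm (by linarith) (sq_nonneg _))
  rw [h5, add_sub_cancel_left] at hv
  exact hv

end IsYosidaLimit

end Semigroup

/-! ### The form domain as a Hilbert space -/

section EllTwoFacts

variable {V : Type*}

theorem EllTwo.hasSum_sq (f : EllTwo V) : HasSum (fun x => f x ^ 2) (‖f‖ ^ 2) := by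
  have h := lp.hasSum_inner (𝕜 := ℝ) f f
  rw [real_inner_self_eq_norm_sq] at h
  refine h.congr_fun ?_
  intro x
  simp [sq]

theorem EllTwo.enorm_sq (f : EllTwo V) : ‖f‖ₑ ^ 2 = ∑' x, ENNReal.ofReal (f x ^ 2) := by
  rw [← ENNReal.ofReal_tsum_of_nonneg (fun x => sq_nonneg _) (EllTwo.hasSum_sq f).summable,
    (EllTwo.hasSum_sq f).tsum_eq, ← ofReal_norm, ENNReal.ofReal_pow (norm_nonneg _)]

theorem EllTwo.exists_of_tsum_ne_top {g : V → ℝ} (hg : ∑' x, ENNReal.ofReal (g x ^ 2) ≠ ∞) :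
    ∃ f : EllTwo V, ∀ x, f x = g x := by
  have h1 : Summable fun x => g x ^ 2 := by
    refine (ENNReal.summable_toReal hg).congr fun x => ?_
    rw [ENNReal.toReal_ofReal (sq_nonneg _)]
  have h2 : Memℓp (E := fun _ : V => ℝ) g 2 := by
    refine memℓp_gen ?_
    simpa using h1
  exact ⟨⟨g, h2⟩, fun x => rfl⟩

theorem EllTwo.continuous_apply (x : V) : Continuous fun f : EllTwo V => f x :=
  (lp.evalCLM ℝ (fun _ : V => ℝ) 2 x).continuous

theorem deltaFun_apply_self (x : V) : deltaFun x x = 1 := by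
  simp [deltaFun]

theorem deltaFun_apply_of_ne {x y : V} (h : y ≠ x) : deltaFun x y = 0 := by
  classical
  simp [deltaFun, lp.single_apply, h]

theorem deltaFun_apply [DecidableEq V] (x y : V) : deltaFun x y = if y = x then 1 else 0 := by
  split_ifs with h
  · rw [h, deltaFun_apply_self]
  · exact deltaFun_apply_of_ne h

theorem inner_deltaFun_right (f : EllTwo V) (x : V) : inner ℝ f (deltaFun x) = f x := by
  let _ := Classical.decEq V
  simp [deltaFun, lp.inner_single_right]

end EllTwoFacts

/-- Pairs of a function and a (rescaled) gradient. -/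
abbrev FormSpace (V : Type*) : Type _ := WithLp 2 (EllTwo V × EllTwo (V × V))

namespace WeightedGraph

variable {V : Type*} (Γ : WeightedGraph V)

/-- The second component of `w` is the gradient of the first, with the weights `c b(x,y) / 2`. -/
def IsGradientPair (c : ℝ) (w : FormSpace V) : Prop :=
  ∀ x y, w.snd (x, y) = √(c * Γ.b x y / 2) * (w.fst x - w.fst y)

theorem isClosed_isGradientPair (c : ℝ) : IsClosed {w | Γ.IsGradientPair c w} := by
  simp only [IsGradientPair, Set.ofPred_forall]
  refine isClosed_iInter fun x => isClosed_iInter fun y => isClosed_eq ?_ ?_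
  · exact (EllTwo.continuous_apply (x, y)).comp (WithLp.sndL 2 ℝ (EllTwo V) (EllTwo (V × V))).continuous
  · exact continuous_const.mul
      (((EllTwo.continuous_apply x).comp (WithLp.fstL 2 ℝ (EllTwo V) (EllTwo (V × V))).continuous).sub
      ((EllTwo.continuous_apply y).comp (WithLp.fstL 2 ℝ (EllTwo V) (EllTwo (V × V))).continuous))

/-- Gradient pairs as a subspace. -/
def gradientPairs (c : ℝ) : Submodule ℝ (FormSpace V) where
  carrier := {w | Γ.IsGradientPair c w}
  zero_mem' := fun x y => by simp
  add_mem' := fun {v w} hv hw x y => by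
    have h1 := hv x y
    have h2 := hw x y
    simp only [WithLp.add_snd, WithLp.add_fst, lp.coeFn_add, Pi.add_apply, h1, h2]
    ring
  smul_mem' := fun a w hw x y => by
    have h1 := hw x y
    simp only [WithLp.smul_snd, WithLp.smul_fst, lp.coeFn_smul, Pi.smul_apply, h1, smul_eq_mul]
    ring

/-- Gradient pairs whose first component vanishes outside `S`. -/
def gradientPairsOn (c : ℝ) (S : Set V) : Submodule ℝ (FormSpace V) where
  carrier := {w | Γ.IsGradientPair c w ∧ ∀ x ∉ S, w.fst x = 0}
  zero_mem' := ⟨(Γ.gradientPairs c).zero_mem, fun x _ => by simp⟩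
  add_mem' := fun {v w} hv hw => ⟨(Γ.gradientPairs c).add_mem hv.1 hw.1, fun x hx => by
    simp [hv.2 x hx, hw.2 x hx]⟩
  smul_mem' := fun a w hw => ⟨(Γ.gradientPairs c).smul_mem a hw.1, fun x hx => by
    simp [hw.2 x hx]⟩

theorem isClosed_gradientPairsOn (c : ℝ) (S : Set V) :
    IsClosed (Γ.gradientPairsOn c S : Set (FormSpace V)) := by
  refine (Γ.isClosed_isGradientPair c).inter (s₂ := {w | ∀ x ∉ S, w.fst x = 0}) ?_
  simp only [Set.ofPred_forall]
  refine isClosed_iInter fun x => isClosed_iInter fun _ => isClosed_eq ?_ continuous_const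
  exact (EllTwo.continuous_apply x).comp (WithLp.fstL 2 ℝ (EllTwo V) (EllTwo (V × V))).continuous

/-- Gradient pairs whose first component has finite support. -/
def gradientPairsFin (c : ℝ) : Submodule ℝ (FormSpace V) where
  carrier := {w | Γ.IsGradientPair c w ∧ (Function.support w.fst).Finite}
  zero_mem' := ⟨(Γ.gradientPairs c).zero_mem, by
    rw [WithLp.zero_fst, lp.coeFn_zero, Function.support_zero]
    exact Set.finite_empty⟩
  add_mem' := fun {v w} hv hw => ⟨(Γ.gradientPairs c).add_mem hv.1 hw.1,
    (hv.2.union hw.2).subset (Function.support_add _ _)⟩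
  smul_mem' := fun a w hw => ⟨(Γ.gradientPairs c).smul_mem a hw.1,
    hw.2.subset (Function.support_const_smul_subset a _)⟩

/-- The closure of the finitely supported gradient pairs, which is a copy of the form domain. -/
noncomputable def formDomain (c : ℝ) : Submodule ℝ (FormSpace V) := (Γ.gradientPairsFin c).topologicalClosure

variable {Γ}

theorem IsGradientPair.enorm_snd_sq {c : ℝ} (hc : 0 ≤ c) {w : FormSpace V}
    (hw : Γ.IsGradientPair c w) : ‖w.snd‖ₑ ^ 2 = ENNReal.ofReal c * Γ.energy w.fst := by
  have h2 : (2 : ℝ≥0∞)⁻¹ = ENNReal.ofReal (2⁻¹) := by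
    rw [ENNReal.ofReal_inv_of_pos two_pos, ENNReal.ofReal_ofNat]
  rw [EllTwo.enorm_sq, energy, div_eq_mul_inv, h2, mul_left_comm, ← ENNReal.ofReal_mul hc, ← ENNReal.tsum_mul_right]
  refine tsum_congr fun p => ?_
  have h1 := hw p.1 p.2
  rw [Prod.mk.eta] at h1
  rw [h1, mul_pow, Real.sq_sqrt (div_nonneg (mul_nonneg hc (Γ.b_nonneg _ _)) two_pos.le),
    ← ENNReal.ofReal_mul
      (mul_nonneg (Γ.b_nonneg _ _) (sq_nonneg _))]
  congr 1
  ring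

theorem enorm_sq_formSpace (w : FormSpace V) : ‖w‖ₑ ^ 2 = ‖w.fst‖ₑ ^ 2 + ‖w.snd‖ₑ ^ 2 := by
  simp only [← ofReal_norm, ← ENNReal.ofReal_pow (norm_nonneg _)]
  rw [← ENNReal.ofReal_add (by positivity) (by positivity), WithLp.prod_norm_sq_eq_of_L2]

theorem exists_isGradientPair {c : ℝ} (hc : 0 ≤ c) {u : EllTwo V} (hu : Γ.energy u < ∞) :
    ∃ w : FormSpace V, w.fst = u ∧ Γ.IsGradientPair c w := by
  have h : ∑' p : V × V, ENNReal.ofReal ((√(c * Γ.b p.1 p.2 / 2) * (u p.1 - u p.2)) ^ 2) ≠ ∞ := by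
    refine ne_top_of_le_ne_top (ENNReal.mul_ne_top (ENNReal.ofReal_ne_top (r := c))
      (ENNReal.mul_ne_top hu.ne (ENNReal.ofNat_ne_top (n := 2)))) ?_
    rw [energy, ENNReal.div_mul_cancel two_ne_zero ENNReal.ofNat_ne_top, ← ENNReal.tsum_mul_left]
    refine ENNReal.tsum_le_tsum fun p => ?_
    rw [← ENNReal.ofReal_mul hc]
    refine ENNReal.ofReal_le_ofReal ?_
    have h1 := mul_nonneg hc (Γ.b_nonneg p.1 p.2)
    rw [mul_pow, Real.sq_sqrt (by positivity), ← mul_assoc]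
    gcongr
    linarith
  obtain ⟨g, hg⟩ := EllTwo.exists_of_tsum_ne_top h
  exact ⟨WithLp.toLp 2 (u, g), rfl, fun x y => hg (x, y)⟩

theorem IsGradientPair.inner_eq {c : ℝ} (hc : 0 ≤ c) {v w : FormSpace V}
    (hv : Γ.IsGradientPair c v) (hw : Γ.IsGradientPair c w) :
    inner ℝ v w = inner ℝ v.fst w.fst + c * Γ.form v.fst w.fst := by
  rw [WithLp.prod_inner_apply]
  congr 1
  change inner ℝ v.snd w.snd = _
  rw [lp.inner_eq_tsum, form, mul_div_assoc', mul_comm, mul_div_assoc, ← tsum_mul_right]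
  refine tsum_congr fun p => ?_
  have h := Real.mul_self_sqrt (div_nonneg (mul_nonneg hc (Γ.b_nonneg p.1 p.2)) two_pos.le)
  have h1 := hv p.1 p.2
  have h2 := hw p.1 p.2
  rw [Prod.mk.eta] at h1 h2
  rw [h1, h2]
  simp only [RCLike.inner_apply, conj_trivial]
  linear_combination (v.fst p.1 - v.fst p.2) * (w.fst p.1 - w.fst p.2) * h

theorem isGradientPair_of_mem_formDomain {c : ℝ} {w : FormSpace V} (hw : w ∈ Γ.formDomain c) :
    Γ.IsGradientPair c w :=
  Submodule.topologicalClosure_minimal (t := Γ.gradientPairs c) _ (fun w h => by exact h.1)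
    (Γ.isClosed_isGradientPair c) hw

theorem IsGradientPair.enorm_sq_le {c : ℝ} (hc : 0 ≤ c) {w : FormSpace V}
    (hw : Γ.IsGradientPair c w) : ‖w‖ₑ ^ 2 ≤ ENNReal.ofReal (1 + c) * Γ.formNormSq w.fst := by
  rw [enorm_sq_formSpace, hw.enorm_snd_sq hc, formNormSq, mul_add, add_comm]
  refine add_le_add ?_ (le_mul_of_one_le_left' ?_)
  · gcongr
    linarith
  · rw [ENNReal.one_le_ofReal]
    linarith

theorem IsGradientPair.formNormSq_le {c : ℝ} (hc : 0 < c) {w : FormSpace V}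
    (hw : Γ.IsGradientPair c w) : Γ.formNormSq w.fst ≤ ENNReal.ofReal (1 + c⁻¹) * ‖w‖ₑ ^ 2 := by
  have h0 := inv_pos.2 hc
  rw [enorm_sq_formSpace, mul_add, formNormSq, add_comm]
  refine add_le_add (le_mul_of_one_le_left' ?_) ?_
  · rw [ENNReal.one_le_ofReal]
    linarith
  · rw [hw.enorm_snd_sq hc.le, ← mul_assoc, ← ENNReal.ofReal_mul (by positivity)]
    refine le_mul_of_one_le_left' ?_
    rw [ENNReal.one_le_ofReal, add_mul, inv_mul_cancel₀ hc.ne']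
    linarith

/-- For gradient pairs, the norm of the pair and the form norm are comparable, with factors `1 + c`
and `1 + c⁻¹`, so the two closures of the finitely supported functions agree. -/
theorem mem_domQD_iff {c : ℝ} (hc : 0 < c) (u : EllTwo V) :
    u ∈ Γ.domQD ↔ ∃ w ∈ Γ.formDomain c, w.fst = u := by
  constructor
  · rintro ⟨hu, happ⟩
    obtain ⟨w, rfl, hw⟩ := exists_isGradientPair hc.le hu
    refine ⟨w, ?_, rfl⟩
    change w ∈ closure _
    rw [EMetric.mem_closure_iff]
    intro ε hε
    have hc1 : ENNReal.ofReal (1 + c) ≠ 0 := by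
      rw [Ne, ENNReal.ofReal_eq_zero]
      linarith
    obtain ⟨v, hv, hlt⟩ := happ (ε ^ 2 / ENNReal.ofReal (1 + c))
      (ENNReal.div_pos (pow_ne_zero 2 hε.ne') ENNReal.ofReal_ne_top)
    rcases eq_or_ne ε ∞ with rfl | hε'
    · exact ⟨0, (Γ.gradientPairsFin c).zero_mem, edist_lt_top _ _⟩
    obtain ⟨w', hw'v, hw'⟩ := exists_isGradientPair (Γ := Γ) (u := w.fst - v) hc.le
      (lt_of_le_of_lt le_self_add (hlt.trans_le le_top))
    refine ⟨w - w', ⟨(Γ.gradientPairs c).sub_mem hw hw', ?_⟩, ?_⟩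
    · rw [WithLp.sub_fst, hw'v, sub_sub_cancel]
      exact hv
    · rw [edist_eq_enorm_sub, sub_sub_cancel]
      refine lt_of_pow_lt_pow_left' 2 ((hw'.enorm_sq_le hc.le).trans_lt ?_)
      rw [hw'v, mul_comm]
      exact (ENNReal.lt_div_iff_mul_lt (.inl hc1) (.inl ENNReal.ofReal_ne_top)).1 hlt
  · rintro ⟨w, hw, rfl⟩
    have hw1 := isGradientPair_of_mem_formDomain hw
    refine ⟨?_, fun ε hε => ?_⟩
    · refine lt_of_le_of_lt (le_self_add.trans (hw1.formNormSq_le hc)) ?_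
      exact ENNReal.mul_lt_top ENNReal.ofReal_lt_top (ENNReal.pow_lt_top enorm_lt_top)
    · have hcont : Continuous fun d : FormSpace V =>
          ENNReal.ofReal (1 + c⁻¹) * ‖w - d‖ₑ ^ 2 :=
        (ENNReal.continuous_const_mul ENNReal.ofReal_ne_top).comp
          ((ENNReal.continuous_pow 2).comp (continuous_const.sub continuous_id).enorm)
      obtain ⟨d, hd1, hd2⟩ := mem_closure_iff.1 (show w ∈ closure _ from hw) _
        (isOpen_lt hcont continuous_const) (show _ < ε by simpa using hε)
      refine ⟨d.fst, hd2.2, ?_⟩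
      have h := IsGradientPair.formNormSq_le hc ((Γ.gradientPairs c).sub_mem hw1 hd2.1)
      exact h.trans_lt hd1

end WeightedGraph

namespace WeightedGraph

variable {V : Type*} {Γ : WeightedGraph V}

/-! ### Testing the form against point masses -/

theorem summable_b_mul (u : EllTwo V) (y : V) : Summable fun z => Γ.b y z * u z := by
  refine Summable.of_norm_bounded ((Γ.b_summable y).mul_right ‖u‖) fun z => ?_
  rw [norm_mul, Real.norm_of_nonneg (Γ.b_nonneg _ _)]
  exact mul_le_mul_of_nonneg_left (lp.norm_apply_le_norm two_ne_zero u z) (Γ.b_nonneg _ _)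

theorem form_deltaFun (u : EllTwo V) (y : V) :
    Γ.form u (deltaFun y) = Γ.deg y * u y - ∑' z, Γ.b y z * u z := by
  classical
  have h1 : HasSum (fun z => Γ.b y z * (u y - u z)) (Γ.deg y * u y - ∑' z, Γ.b y z * u z) := by
    simp only [mul_sub]
    exact ((Γ.b_summable y).hasSum.mul_right (u y)).sub (summable_b_mul u y).hasSum
  -- Pairs with first entry `y` and pairs with second entry `y` contribute equally, which cancels
  -- the factor `1/2`. The pair `(y, y)` occurs in both families, but its difference vanishes.
  have h2 : HasSum (fun p : V × V => if p.1 = y then Γ.b y p.2 * (u y - u p.2) else 0)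
      (Γ.deg y * u y - ∑' z, Γ.b y z * u z) := by
    refine (Function.Injective.hasSum_iff (g := fun z : V => (y, z)) (fun _ _ h => (Prod.mk.inj h).2)
      fun p hp => if_neg ?_).1 (by simpa [Function.comp_def] using h1)
    rintro rfl
    exact hp ⟨p.2, rfl⟩
  have h3 : HasSum (fun p : V × V => if p.2 = y then Γ.b y p.1 * (u y - u p.1) else 0)
      (Γ.deg y * u y - ∑' z, Γ.b y z * u z) := by
    refine (Function.Injective.hasSum_iff (g := fun z : V => (z, y)) (fun _ _ h => (Prod.mk.inj h).1)
      fun p hp => if_neg ?_).1 (by simpa [Function.comp_def] using h1)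
    rintro rfl
    exact hp ⟨p.1, rfl⟩
  have h4 := (h2.add h3).tsum_eq
  rw [form, div_eq_iff two_ne_zero, mul_two, ← h4]
  refine tsum_congr fun p => ?_
  simp only [deltaFun_apply]
  by_cases hp1 : p.1 = y <;> by_cases hp2 : p.2 = y
  · simp [hp1, hp2]
  · simp [hp1, hp2]
  · simp [hp1, hp2, Γ.b_symm p.1 y]
    ring
  · simp [hp1, hp2]

theorem energy_deltaFun_lt_top (y : V) : Γ.energy (deltaFun y) < ∞ := by
  classical
  have hs : ∑' z, ENNReal.ofReal (Γ.b y z) ≠ ∞ := (Γ.b_summable y).tsum_ofReal_ne_top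
  have h1 : ∑' p : V × V, (if p.1 = y then ENNReal.ofReal (Γ.b y p.2) else 0) ≠ ∞ := by
    rw [ENNReal.tsum_prod (f := fun a z => if a = y then ENNReal.ofReal (Γ.b y z) else 0),
      tsum_eq_single y fun a ha => by simp [ha]]
    simpa using hs
  have h2 : ∑' p : V × V, (if p.2 = y then ENNReal.ofReal (Γ.b y p.1) else 0) ≠ ∞ := by
    rw [ENNReal.tsum_prod (f := fun z a => if a = y then ENNReal.ofReal (Γ.b y z) else 0),
      ENNReal.tsum_comm, tsum_eq_single y fun a ha => by simp [ha]]
    simpa using hs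
  refine lt_of_le_of_lt ?_ (ENNReal.div_lt_top (ENNReal.add_ne_top.2 ⟨h1, h2⟩) two_ne_zero)
  rw [energy, ← ENNReal.tsum_add]
  gcongr with p
  simp only [deltaFun_apply]
  by_cases hp1 : p.1 = y <;> by_cases hp2 : p.2 = y
  · simp [hp1, hp2]
  · simp [hp1, hp2]
  · simp [hp1, hp2, Γ.b_symm p.1 y]
  · simp [hp1, hp2]

theorem exists_isGradientPair_deltaFun {c : ℝ} (hc : 0 ≤ c) (y : V) :
    ∃ w : FormSpace V, w.fst = deltaFun y ∧ Γ.IsGradientPair c w :=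
  exists_isGradientPair hc (energy_deltaFun_lt_top y)

theorem exists_mem_formDomain_deltaFun {c : ℝ} (hc : 0 ≤ c) (y : V) :
    ∃ w ∈ Γ.formDomain c, w.fst = deltaFun y := by
  obtain ⟨w, hw, hw1⟩ := exists_isGradientPair_deltaFun (Γ := Γ) hc y
  refine ⟨w, Submodule.le_topologicalClosure _ ⟨hw1, (Set.finite_singleton y).subset ?_⟩, hw⟩
  intro x hx
  rw [hw] at hx
  by_contra hxy
  exact hx (deltaFun_apply_of_ne hxy)

variable (Γ)

/-! ### The resolvent -/

/-- The embedding of the form domain into `ℓ²`. -/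
noncomputable def formDomainFst (c : ℝ) : Γ.formDomain c →L[ℝ] EllTwo V :=
  (WithLp.fstL 2 ℝ (EllTwo V) (EllTwo (V × V))).comp (Γ.formDomain c).subtypeL

instance (c : ℝ) : CompleteSpace (Γ.formDomain c) :=
  (Submodule.isClosed_topologicalClosure _).completeSpace_coe

/-- The resolvent `(1 + c L)⁻¹`. -/
noncomputable def resolvent (c : ℝ) : EllTwo V →L[ℝ] EllTwo V :=
  (Γ.formDomainFst c).comp (ContinuousLinearMap.adjoint (Γ.formDomainFst c))

variable {Γ}

theorem norm_formDomainFst_le (c : ℝ) : ‖Γ.formDomainFst c‖ ≤ 1 := by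
  refine ContinuousLinearMap.opNorm_le_bound _ zero_le_one fun w => ?_
  rw [one_mul]
  have h := WithLp.prod_norm_sq_eq_of_L2 (w : FormSpace V)
  refine le_of_sq_le_sq ?_ (norm_nonneg _)
  change ‖(w : FormSpace V).fst‖ ^ 2 ≤ ‖(w : FormSpace V)‖ ^ 2
  rw [h]
  exact le_add_of_nonneg_right (sq_nonneg _)

theorem norm_resolvent_le (c : ℝ) : ‖Γ.resolvent c‖ ≤ 1 := by
  refine (ContinuousLinearMap.opNorm_comp_le _ _).trans ?_
  rw [LinearIsometryEquiv.norm_map]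
  exact mul_le_one₀ (norm_formDomainFst_le c) (norm_nonneg (Γ.formDomainFst c))
    (norm_formDomainFst_le c)

theorem isSelfAdjoint_resolvent (c : ℝ) : IsSelfAdjoint (Γ.resolvent c) := by
  rw [ContinuousLinearMap.isSelfAdjoint_iff', resolvent, ContinuousLinearMap.adjoint_comp,
    ContinuousLinearMap.adjoint_adjoint]

/-- The adjoint of the embedding sends `f` to the Riesz representative of `v ↦ ⟨f, v⟩` for the inner
product `⟨u, v⟩ + c Q(u, v)`, so the resolvent solves `u + c L u = f` weakly. -/
theorem isLD_iff_resolvent {c : ℝ} (hc : 0 < c) (u w : EllTwo V) :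
    Γ.IsLD u w ↔ Γ.resolvent c (u + c • w) = u := by
  constructor
  · rintro ⟨hu, h⟩
    obtain ⟨ω, hω, rfl⟩ := (mem_domQD_iff hc u).1 hu
    have h1 : ContinuousLinearMap.adjoint (Γ.formDomainFst c) (ω.fst + c • w) = ⟨ω, hω⟩ := by
      refine ext_inner_right ℝ fun v => ?_
      rw [ContinuousLinearMap.adjoint_inner_left]
      have h2 := h _ ((mem_domQD_iff hc _).2 ⟨v, v.2, rfl⟩)
      change inner ℝ _ (v : FormSpace V).fst = inner ℝ ω (v : FormSpace V)
      rw [(isGradientPair_of_mem_formDomain hω).inner_eq hc.le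
        (isGradientPair_of_mem_formDomain v.2), h2, inner_add_left, real_inner_smul_left]
    change Γ.formDomainFst c (ContinuousLinearMap.adjoint (Γ.formDomainFst c) _) = _
    rw [h1]
    rfl
  · intro h
    set ω := ContinuousLinearMap.adjoint (Γ.formDomainFst c) (u + c • w) with hω
    have hu : (ω : FormSpace V).fst = u := h
    refine ⟨(mem_domQD_iff hc _).2 ⟨ω, ω.2, hu⟩, fun v hv => ?_⟩
    obtain ⟨ν, hν, rfl⟩ := (mem_domQD_iff hc v).1 hv
    have h1 := ContinuousLinearMap.adjoint_inner_left (Γ.formDomainFst c) ⟨ν, hν⟩ (u + c • w)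
    rw [← hω] at h1
    change inner ℝ (ω : FormSpace V) ν = inner ℝ _ ν.fst at h1
    rw [(isGradientPair_of_mem_formDomain ω.2).inner_eq hc.le
      (isGradientPair_of_mem_formDomain hν), hu, inner_add_left, real_inner_smul_left] at h1
    exact mul_left_cancel₀ hc.ne' (add_left_cancel h1)

/-- If `f` is orthogonal to the range of `ι ι*`, where `ι` is the embedding, then `‖ι* f‖² = 0`.
Thus `f` is orthogonal to the form domain, in particular to every `δ_y`. -/
theorem dense_dom_isLD : Dense {u : EllTwo V | ∃ w, Γ.IsLD u w} := by
  have h1 : (LinearMap.range (Γ.resolvent 1).toLinearMap).topologicalClosure = ⊤ := by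
    rw [Submodule.topologicalClosure_eq_top_iff, Submodule.eq_bot_iff]
    intro f hf
    have h2 : inner ℝ (Γ.resolvent 1 f) f = 0 := (Submodule.mem_orthogonal _ f).1 hf _ ⟨f, rfl⟩
    have h3 : ContinuousLinearMap.adjoint (Γ.formDomainFst 1) f = 0 := by
      rw [← inner_self_eq_zero (𝕜 := ℝ), ContinuousLinearMap.adjoint_inner_left, real_inner_comm]
      exact h2
    ext y
    obtain ⟨ω, hω, hy⟩ := exists_mem_formDomain_deltaFun (Γ := Γ) zero_le_one y
    have h4 := ContinuousLinearMap.adjoint_inner_left (Γ.formDomainFst 1) ⟨ω, hω⟩ f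
    rw [h3, inner_zero_left] at h4
    change 0 = inner ℝ f ω.fst at h4
    rw [hy, inner_deltaFun_right] at h4
    exact h4.symm
  have h2 := (Submodule.dense_iff_topologicalClosure_eq_top).2 h1
  refine h2.mono ?_
  rintro _ ⟨f, rfl⟩
  refine ⟨f - Γ.resolvent 1 f, (isLD_iff_resolvent one_pos _ _).2 ?_⟩
  rw [one_smul]
  exact congrArg _ (add_sub_cancel _ _)

theorem isResolventFamily_resolvent : IsResolventFamily Γ.resolvent Γ.IsLD where
  norm_le c _ := norm_resolvent_le c
  selfAdjoint c _ := isSelfAdjoint_resolvent c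
  graph_iff _ hc := isLD_iff_resolvent hc
  dense := dense_dom_isLD

/-! ### Galerkin approximation of the resolvent -/

/-- Approximation of the resolvent by solutions of the resolvent equation on a finite set, with
Dirichlet boundary conditions. -/
theorem exists_galerkin {c : ℝ} (hc : 0 < c) (f : EllTwo V) {ε : ℝ} (hε : 0 < ε) :
    ∃ (K : Set V) (u : EllTwo V), K.Finite ∧ (∀ x ∉ K, u x = 0) ∧
      (∀ y ∈ K, (1 + c * Γ.deg y) * u y = f y + c * ∑' z, Γ.b y z * u z) ∧
      ∀ x, |Γ.resolvent c f x - u x| < ε := by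
  set ω := ContinuousLinearMap.adjoint (Γ.formDomainFst c) f with hω
  obtain ⟨d, hd, hdω⟩ := Metric.mem_closure_iff.1 (show (ω : FormSpace V) ∈ closure _ from ω.2) ε hε
  set K := Function.support d.fst
  let S := Γ.gradientPairsOn c K
  have : CompleteSpace S := (Γ.isClosed_gradientPairsOn c K).completeSpace_coe
  -- Orthogonality of `ω - p` to `δ_y` for `y ∈ K` gives the equation at `y`; minimality of the
  -- distance makes `p` at least as close to `ω` as the finitely supported `d`.
  set p := S.starProjection (ω : FormSpace V)
  have hp : p ∈ S := Submodule.starProjection_apply_mem _ _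
  have hpd : p ∈ Γ.formDomain c := Submodule.le_topologicalClosure _ ⟨hp.1, hd.2.subset fun x hx => by
    by_contra h
    exact hx (hp.2 x h)⟩
  refine ⟨K, p.fst, hd.2, hp.2, fun y hy => ?_, fun x => ?_⟩
  · obtain ⟨ν, hν, hν1⟩ := exists_isGradientPair_deltaFun (Γ := Γ) hc.le y
    have hνS : ν ∈ S := ⟨hν1, fun x hx => by
      rw [hν]
      exact deltaFun_apply_of_ne (fun h => hx (h ▸ hy))⟩
    have hνd : ν ∈ Γ.formDomain c := Submodule.le_topologicalClosure _ ⟨hν1,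
      hd.2.subset fun x hx => by
        by_contra h
        exact hx (hνS.2 x h)⟩
    have h1 : inner ℝ ((ω : FormSpace V) - p) ν = 0 :=
      S.starProjection_inner_eq_zero _ ν hνS
    have h2 := ContinuousLinearMap.adjoint_inner_left (Γ.formDomainFst c) ⟨ν, hνd⟩ f
    rw [← hω] at h2
    change inner ℝ (ω : FormSpace V) ν = inner ℝ f ν.fst at h2
    rw [inner_sub_left, h2, IsGradientPair.inner_eq hc.le hp.1 hν1, hν, inner_deltaFun_right,
      inner_deltaFun_right, form_deltaFun] at h1
    linarith
  · have h1 : ‖(ω : FormSpace V) - p‖ ≤ ‖(ω : FormSpace V) - d‖ := by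
      have hdS : d ∈ S := ⟨hd.1, fun x hx => by simpa [K] using hx⟩
      rw [Submodule.starProjection_minimal]
      exact ciInf_le ⟨0, by rintro _ ⟨_, rfl⟩; exact norm_nonneg _⟩ (⟨d, hdS⟩ : S)
    have h2 : ‖Γ.formDomainFst c (ω - ⟨p, hpd⟩)‖ ≤ ‖(ω : FormSpace V) - p‖ := by
      simpa using (Γ.formDomainFst c).le_of_opNorm_le (norm_formDomainFst_le c) (ω - ⟨p, hpd⟩)
    have h3 := lp.norm_apply_le_norm two_ne_zero (Γ.formDomainFst c (ω - ⟨p, hpd⟩)) x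
    rw [dist_eq_norm] at hdω
    exact (h3.trans (h2.trans h1)).trans_lt hdω

end WeightedGraph

namespace WeightedGraph

variable {V : Type*} {Γ : WeightedGraph V}

/-! ### The resolvent is Markovian -/

theorem tsum_b_mul_le (u : EllTwo V) (y : V) {M : ℝ} (hM : ∀ z, u z ≤ M) :
    ∑' z, Γ.b y z * u z ≤ Γ.deg y * M := by
  rw [deg, ← tsum_mul_right]
  exact (summable_b_mul u y).tsum_le_tsum
    (fun z => mul_le_mul_of_nonneg_left (hM z) (Γ.b_nonneg _ _)) ((Γ.b_summable y).mul_right M)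

/-- Maximum principle for the resolvent equation on a finite set. -/
theorem le_of_galerkin {c : ℝ} (hc : 0 < c) {K : Set V} (hK : K.Finite) {f u : EllTwo V} {M : ℝ}
    (hM : 0 ≤ M) (hu : ∀ x ∉ K, u x = 0)
    (h : ∀ y ∈ K, (1 + c * Γ.deg y) * u y = f y + c * ∑' z, Γ.b y z * u z)
    (hf : ∀ x, f x ≤ M) (x : V) : u x ≤ M := by
  by_contra! hx
  have hxK : x ∈ K := by
    by_contra hxK
    rw [hu x hxK] at hx
    exact absurd hM (not_le.2 hx)
  obtain ⟨y, hy, hmax⟩ := hK.exists_maximalFor u K ⟨x, hxK⟩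
  have hmax' : ∀ z ∈ K, u z ≤ u y := fun z hz => (le_total (u z) (u y)).elim id (hmax hz)
  have hMy : M < u y := hx.trans_le (hmax' x hxK)
  have h1 : ∀ z, u z ≤ u y := fun z => by
    by_cases hz : z ∈ K
    · exact hmax' z hz
    · rw [hu z hz]
      exact hM.trans hMy.le
  -- At the maximum point `y` the neighbour sum is at most `deg y * u y`, so the equation leaves `u
  -- y ≤ f y ≤ M`, a contradiction.
  have h2 := mul_le_mul_of_nonneg_left (tsum_b_mul_le (Γ := Γ) u y h1) hc.le
  have h3 := h y hy
  have h4 := hf y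
  linarith

theorem resolvent_le {c : ℝ} (hc : 0 < c) {f : EllTwo V} {M : ℝ} (hM : 0 ≤ M)
    (hf : ∀ x, f x ≤ M) (x : V) : Γ.resolvent c f x ≤ M := by
  refine le_of_forall_pos_le_add fun ε hε => ?_
  obtain ⟨K, u, hK, hu, h, happ⟩ := exists_galerkin (Γ := Γ) hc f hε
  have h1 := le_of_galerkin hc hK hM hu h hf x
  linarith [le_abs_self (Γ.resolvent c f x - u x), happ x]

theorem resolvent_nonneg {c : ℝ} (hc : 0 < c) {f : EllTwo V} (hf : ∀ x, 0 ≤ f x) (x : V) :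
    0 ≤ Γ.resolvent c f x := by
  have h := resolvent_le (Γ := Γ) hc (f := -f) le_rfl
    (fun x => by simpa using hf x) x
  rw [map_neg] at h
  simpa using h

theorem resolvent_mem_Icc {c : ℝ} (hc : 0 < c) {f : EllTwo V} (hf : ∀ x, 0 ≤ f x ∧ f x ≤ 1)
    (x : V) : 0 ≤ Γ.resolvent c f x ∧ Γ.resolvent c f x ≤ 1 :=
  ⟨resolvent_nonneg hc (fun x => (hf x).1) x, resolvent_le hc zero_le_one (fun x => (hf x).2) x⟩

/-! ### Existence of the semigroup -/

/-- The bounds `0 ≤ f ≤ 1` pass from the resolvent to its powers, then to their Poisson averages,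
and pointwise to the Yosida limit. -/
theorem exists_isSemigroupQD : ∃ T, Γ.IsSemigroupQD T := by
  have h := isResolventFamily_resolvent (Γ := Γ)
  obtain ⟨T, hT⟩ := h.exists_limit
  have hT' : IsYosidaLimit Γ.resolvent T := hT
  refine ⟨T, fun t ht => hT'.isSelfAdjoint h ht.le, fun t s ht hs => hT'.apply_add h ht.le hs.le,
    fun t ht => hT'.norm_apply_le h ht.le, hT'.tendsto_zero h, fun t ht f hf x => ?_,
    hT'.generator_iff h⟩
  have h1 : ∀ n : ℕ, NormedSpace.exp (t • yosidaGen Γ.resolvent (1 / ((n : ℝ) + 1))) f x ∈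
      Set.Icc (0 : ℝ) 1 := by
    intro n
    have h0 : (0 : ℝ) < 1 / ((n : ℝ) + 1) := Nat.one_div_pos_of_nat
    refine exp_smul_sub_one_apply_mem_Icc (inv_nonneg.2 h0.le) ht.le
      (lp.evalCLM ℝ (fun _ : V => ℝ) 2 x) f fun m => ?_
    have h2 : ∀ y, 0 ≤ (Γ.resolvent (1 / ((n : ℝ) + 1)) ^ m) f y ∧
        (Γ.resolvent (1 / ((n : ℝ) + 1)) ^ m) f y ≤ 1 := by
      induction m with
      | zero => exact hf
      | succ m ih =>
        rw [pow_succ']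
        exact resolvent_mem_Icc h0 ih
    exact h2 x
  exact isClosed_Icc.mem_of_tendsto
    (((EllTwo.continuous_apply x).tendsto _).comp (hT t ht.le f)) (.of_forall h1)

/-! ### Iteration of the Green equation -/

open Classical in
/-- Partial sums of the Neumann series of the Green function with pole at `x`. -/
noncomputable def greenIter (Γ : WeightedGraph V) (x : V) : ℕ → V → ℝ≥0∞
  | 0, _ => 0
  | N + 1, y => ((if y = x then 1 else 0) +
      ∑' z, ENNReal.ofReal (Γ.b y z) * Γ.greenIter x N z) / ENNReal.ofReal (Γ.deg y)

theorem tsum_ofReal_b (y : V) : ∑' z, ENNReal.ofReal (Γ.b y z) = ENNReal.ofReal (Γ.deg y) :=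
  (ENNReal.ofReal_tsum_of_nonneg (Γ.b_nonneg y) (Γ.b_summable y)).symm

theorem deg_nonneg (y : V) : 0 ≤ Γ.deg y := tsum_nonneg (Γ.b_nonneg y)

theorem ofReal_deltaFun [DecidableEq V] (x y : V) :
    ENNReal.ofReal (deltaFun x y) = if y = x then 1 else 0 := by
  rw [deltaFun_apply]
  split_ifs <;> simp

theorem ofReal_tsum_le {ι : Type*} {f : ι → ℝ} (hf : Summable f) :
    ENNReal.ofReal (∑' i, f i) ≤ ∑' i, ENNReal.ofReal (f i) := by
  have h1 : Summable fun i => max (f i) 0 :=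
    Summable.of_nonneg_of_le (fun i => le_max_right _ _)
      (fun i => max_le (le_abs_self _) (abs_nonneg _)) hf.abs
  calc ENNReal.ofReal (∑' i, f i) ≤ ENNReal.ofReal (∑' i, max (f i) 0) :=
        ENNReal.ofReal_le_ofReal (hf.tsum_le_tsum (fun i => le_max_left _ _) h1)
    _ = ∑' i, ENNReal.ofReal (f i) := by
        rw [ENNReal.ofReal_tsum_of_nonneg (fun i => le_max_right _ _) h1]
        exact tsum_congr fun i => by simp [ENNReal.ofReal_max]

/-- Solutions of the resolvent equation on a finite set are bounded by the Neumann series. -/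
theorem ofReal_le_greenIter_add {α : ℝ} (hα : 0 < α) (hdeg : ∀ y, 0 < Γ.deg y) {K : Set V}
    {u : EllTwo V} {x : V} (hu : ∀ y ∉ K, u y = 0)
    (h : ∀ y ∈ K, (α + Γ.deg y) * u y = deltaFun x y + ∑' z, Γ.b y z * u z)
    {q : ℝ} (hq : ∀ y ∈ K, Γ.deg y ≤ q * (α + Γ.deg y)) (N : ℕ) (y : V) :
    ENNReal.ofReal (u y) ≤ Γ.greenIter x N y + ENNReal.ofReal (‖u‖ * q ^ N) := by
  classical
  induction N generalizing y with
  | zero =>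
    rw [greenIter, zero_add, pow_zero, mul_one]
    exact ENNReal.ofReal_le_ofReal ((le_abs_self _).trans (lp.norm_apply_le_norm two_ne_zero u y))
  | succ N ih =>
    by_cases hy : y ∈ K
    swap
    · simp [hu y hy]
    have hd := hdeg y
    have hq0 : 0 ≤ q := by
      by_contra! hq0
      have := hq y hy
      nlinarith
    have hd0 : ENNReal.ofReal (Γ.deg y) ≠ 0 := by simpa using hd
    have hb0 : 0 < α + Γ.deg y := by positivity
    have hs : ENNReal.ofReal (∑' z, Γ.b y z * u z) ≤
        ∑' z, ENNReal.ofReal (Γ.b y z) * Γ.greenIter x N z +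
          ENNReal.ofReal (Γ.deg y) * ENNReal.ofReal (‖u‖ * q ^ N) := by
      refine (ofReal_tsum_le (summable_b_mul u y)).trans ?_
      rw [← tsum_ofReal_b, ← ENNReal.tsum_mul_right, ← ENNReal.tsum_add]
      refine ENNReal.tsum_le_tsum fun z => ?_
      rw [ENNReal.ofReal_mul (Γ.b_nonneg _ _), ← mul_add]
      gcongr
      exact ih z
    -- Inserting the induction hypothesis into the equation costs a factor `deg y / (α + deg y) ≤ q`
    -- on the remainder.
    have h1 : ENNReal.ofReal (α + Γ.deg y) * ENNReal.ofReal (u y) ≤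
        ENNReal.ofReal (Γ.deg y) * Γ.greenIter x (N + 1) y +
          ENNReal.ofReal (Γ.deg y) * ENNReal.ofReal (‖u‖ * q ^ N) := by
      rw [← ENNReal.ofReal_mul hb0.le, h y hy, greenIter,
        ENNReal.mul_div_cancel hd0 ENNReal.ofReal_ne_top, add_assoc]
      refine ENNReal.ofReal_add_le.trans ?_
      rw [ofReal_deltaFun]
      gcongr
    have hb1 : ENNReal.ofReal (α + Γ.deg y) ≠ 0 := by simpa using hb0
    rw [← ENNReal.mul_le_mul_iff_right hb1 ENNReal.ofReal_ne_top]
    refine h1.trans ?_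
    rw [mul_add]
    refine add_le_add ?_ ?_
    · gcongr
      linarith
    · rw [← ENNReal.ofReal_mul hd.le, ← ENNReal.ofReal_mul hb0.le]
      refine ENNReal.ofReal_le_ofReal ?_
      have h2 : 0 ≤ ‖u‖ * q ^ N := by positivity
      have h3 := mul_le_mul_of_nonneg_right (hq y hy) h2
      rw [pow_succ]
      linarith

/-- With `c = α⁻¹`, the left-hand side is `(α + L)⁻¹ δ_x` at `y`. The bound is uniform in `α`, hence
survives the limit to the Green function. -/
theorem ofReal_resolvent_deltaFun_le {α : ℝ} (hα : 0 < α) (hdeg : ∀ y, 0 < Γ.deg y) (x y : V) :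
    ENNReal.ofReal (Γ.resolvent α⁻¹ (α⁻¹ • deltaFun x) y) ≤ ⨆ N, Γ.greenIter x N y := by
  have hc := inv_pos.2 hα
  refine ENNReal.le_of_forall_pos_le_add fun ε hε _ => ?_
  obtain ⟨K, u, hK, hu, h, happ⟩ := exists_galerkin (Γ := Γ) hc (α⁻¹ • deltaFun x)
    (NNReal.coe_pos.2 hε)
  have h' : ∀ y ∈ K, (α + Γ.deg y) * u y = deltaFun x y + ∑' z, Γ.b y z * u z := by
    intro y hy
    have h1 := congrArg (α * ·) (h y hy)
    simp only [lp.coeFn_smul, Pi.smul_apply, smul_eq_mul, mul_add, mul_inv_cancel_left₀ hα.ne',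
      mul_one, ← mul_assoc] at h1
    rw [← h1]
  -- A uniform ratio below `1` exists because `K` is finite; the degrees may be unbounded on `V`.
  obtain ⟨q, hq1, hq⟩ : ∃ q : ℝ, q < 1 ∧ ∀ y ∈ K, Γ.deg y ≤ q * (α + Γ.deg y) := by
    rcases K.eq_empty_or_nonempty with rfl | hne
    · exact ⟨0, zero_lt_one, by simp⟩
    obtain ⟨m, hm, hmax⟩ := hK.exists_maximalFor (fun y => Γ.deg y / (α + Γ.deg y)) K hne
    have hp : ∀ y, 0 < α + Γ.deg y := fun y => add_pos hα (hdeg y)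
    refine ⟨Γ.deg m / (α + Γ.deg m), ?_, fun y hy => ?_⟩
    · rw [div_lt_one (hp m)]
      linarith
    · rw [← div_le_iff₀ (hp y)]
      exact (le_total _ _).elim id fun h => hmax hy h
  have hsup : ENNReal.ofReal (u y) ≤ ⨆ N, Γ.greenIter x N y := by
    by_cases hy : y ∈ K
    swap
    · simp [hu y hy]
    have hq0 : 0 ≤ q := by
      by_contra! hq0
      have := hq y hy
      have := hdeg y
      nlinarith
    have ht : Tendsto (fun N : ℕ => (⨆ N, Γ.greenIter x N y) + ENNReal.ofReal (‖u‖ * q ^ N)) atTop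
        (𝓝 ((⨆ N, Γ.greenIter x N y) + ENNReal.ofReal (‖u‖ * 0))) :=
      (ENNReal.tendsto_ofReal
        ((tendsto_pow_atTop_nhds_zero_of_lt_one hq0 hq1).const_mul _)).const_add _
    rw [mul_zero, ENNReal.ofReal_zero, add_zero] at ht
    refine ge_of_tendsto' ht fun N => (ofReal_le_greenIter_add hα hdeg hu h' hq N y).trans ?_
    gcongr
    exact le_iSup (fun N => Γ.greenIter x N y) N
  have h2 : Γ.resolvent α⁻¹ (α⁻¹ • deltaFun x) y ≤ u y + ε := by
    linarith [le_abs_self (Γ.resolvent α⁻¹ (α⁻¹ • deltaFun x) y - u y), happ y]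
  refine (ENNReal.ofReal_le_ofReal h2).trans (ENNReal.ofReal_add_le.trans ?_)
  rw [ENNReal.ofReal_coe_nnreal]
  gcongr

end WeightedGraph

namespace WeightedGraph

variable {V : Type*} {Γ : WeightedGraph V}

/-! ### Laplace transform of the semigroup -/

namespace IsSemigroupQD

variable {T : ℝ → EllTwo V →L[ℝ] EllTwo V}

theorem norm_sub_le (hT : Γ.IsSemigroupQD T) (f : EllTwo V) {s t : ℝ} (hs : 0 < s) (hst : s < t) :
    ‖T t f - T s f‖ ≤ ‖T (t - s) f - f‖ := by
  have h := hT.semigroup s (t - s) hs (sub_pos.2 hst)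
  rw [add_sub_cancel] at h
  rw [h, ContinuousLinearMap.comp_apply, ← map_sub]
  exact hT.contractive s hs _

theorem continuousOn (hT : Γ.IsSemigroupQD T) (f : EllTwo V) :
    ContinuousOn (fun t => T t f) (Set.Ioi 0) := by
  rw [Metric.continuousOn_iff]
  intro s hs ε hε
  obtain ⟨δ, hδ, h⟩ := Metric.tendsto_nhdsWithin_nhds.1 (hT.strongly_continuous f) ε hε
  refine ⟨δ, hδ, fun t ht hst => ?_⟩
  rw [Real.dist_eq] at hst
  rcases lt_trichotomy s t with hlt | rfl | hlt
  · rw [dist_eq_norm]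
    refine (hT.norm_sub_le f hs hlt).trans_lt ?_
    rw [← dist_eq_norm]
    refine h (sub_pos.2 hlt) ?_
    rwa [dist_zero_right, Real.norm_eq_abs]
  · simpa using hε
  · rw [dist_comm, dist_eq_norm]
    refine (hT.norm_sub_le f ht hlt).trans_lt ?_
    rw [← dist_eq_norm]
    refine h (sub_pos.2 hlt) ?_
    rwa [dist_zero_right, Real.norm_eq_abs, abs_sub_comm]

theorem integrableOn_laplace (hT : Γ.IsSemigroupQD T) {α : ℝ} (hα : 0 < α) (f : EllTwo V) :
    IntegrableOn (fun t => Real.exp (-α * t) • T t f) (Set.Ioi 0) := by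
  have h1 : IntegrableOn (fun t => Real.exp (-α * t) * ‖f‖) (Set.Ioi 0) :=
    (exp_neg_integrableOn_Ioi 0 hα).mul_const _
  refine Integrable.mono' h1 ?_ ?_
  · refine ContinuousOn.aestronglyMeasurable ?_ measurableSet_Ioi
    exact ContinuousOn.smul (f := fun t : ℝ => Real.exp (-α * t)) (by fun_prop) (hT.continuousOn f)
  · refine (ae_restrict_mem measurableSet_Ioi).mono fun t ht => ?_
    rw [norm_smul, Real.norm_of_nonneg (Real.exp_nonneg _)]
    exact mul_le_mul_of_nonneg_left (hT.contractive t ht f) (Real.exp_nonneg _)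

theorem tendsto_average (hT : Γ.IsSemigroupQD T) {α : ℝ} (hα : 0 < α) (f : EllTwo V) :
    Tendsto (fun h : ℝ => h⁻¹ • ∫ t in Set.Ioc 0 h, Real.exp (-α * t) • T t f) (𝓝[>] 0) (𝓝 f) := by
  have hF : Tendsto (fun t : ℝ => Real.exp (-α * t) • T t f) (𝓝[>] 0) (𝓝 f) := by
    have h1 : Tendsto (fun t : ℝ => Real.exp (-α * t)) (𝓝[>] 0) (𝓝 1) :=
      tendsto_nhdsWithin_of_tendsto_nhds (Continuous.tendsto' (by fun_prop) _ _ (by simp))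
    simpa using h1.smul (hT.strongly_continuous f)
  rw [Metric.tendsto_nhds]
  intro ε hε
  obtain ⟨δ, hδ, h⟩ := Metric.tendsto_nhdsWithin_nhds.1 hF (ε / 2) (half_pos hε)
  filter_upwards [Ioo_mem_nhdsGT hδ] with h' ⟨h0, h0δ⟩
  have hint : IntegrableOn (fun t => Real.exp (-α * t) • T t f) (Set.Ioc 0 h') :=
    (hT.integrableOn_laplace hα f).mono_set Set.Ioc_subset_Ioi_self
  have hvol : volume (Set.Ioc (0 : ℝ) h') < ∞ := measure_Ioc_lt_top
  have h2 : ‖∫ t in Set.Ioc 0 h', (Real.exp (-α * t) • T t f - f)‖ ≤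
      ε / 2 * volume.real (Set.Ioc 0 h') := by
    refine norm_setIntegral_le_of_norm_le_const hvol fun t ht => ?_
    rw [← dist_eq_norm]
    refine (h ht.1 ?_).le
    rw [dist_zero_right, Real.norm_of_nonneg ht.1.le]
    exact ht.2.trans_lt h0δ
  have hreal : volume.real (Set.Ioc 0 h') = h' := by
    rw [Real.volume_real_Ioc_of_le h0.le, sub_zero]
  rw [integral_sub hint (integrableOn_const hvol.ne), setIntegral_const, hreal] at h2
  have h3 : (h'⁻¹ • ∫ t in Set.Ioc 0 h', Real.exp (-α * t) • T t f) - f =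
      h'⁻¹ • ((∫ t in Set.Ioc 0 h', Real.exp (-α * t) • T t f) - h' • f) := by
    rw [smul_sub, inv_smul_smul₀ h0.ne']
  rw [dist_eq_norm, h3, norm_smul, norm_inv, Real.norm_of_nonneg h0.le, inv_mul_lt_iff₀ h0]
  refine h2.trans_lt ?_
  rw [mul_comm]
  exact mul_lt_mul_of_pos_left (half_lt_self hε) h0

theorem apply_laplace (hT : Γ.IsSemigroupQD T) {α : ℝ} (hα : 0 < α) (f : EllTwo V) {h : ℝ}
    (hh : 0 < h) : T h (∫ t in Set.Ioi 0, Real.exp (-α * t) • T t f) =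
      Real.exp (α * h) • ((∫ t in Set.Ioi 0, Real.exp (-α * t) • T t f) -
        ∫ t in Set.Ioc 0 h, Real.exp (-α * t) • T t f) := by
  have hint := hT.integrableOn_laplace hα f
  have h1 : (∫ t in Set.Ioi 0, Real.exp (-α * t) • T t f) =
      (∫ t in Set.Ioc 0 h, Real.exp (-α * t) • T t f) +
        ∫ t in Set.Ioi h, Real.exp (-α * t) • T t f := by
    rw [← Set.Ioc_union_Ioi_eq_Ioi hh.le]
    exact setIntegral_union (Set.Ioc_disjoint_Ioi le_rfl) measurableSet_Ioi
      (hint.mono_set Set.Ioc_subset_Ioi_self) (hint.mono_set (Set.Ioi_subset_Ioi hh.le))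
  nth_rewrite 2 [h1]
  rw [add_sub_cancel_left, ← ContinuousLinearMap.integral_comp_comm _ hint, ← integral_smul]
  have h2 := (measurePreserving_add_right volume h).setIntegral_preimage_emb
    (measurableEmbedding_addRight h)
    (fun t => Real.exp (α * h) • Real.exp (-α * t) • T t f) (Set.Ioi h)
  rw [Set.preimage_add_const_Ioi, sub_self] at h2
  rw [← h2]
  refine setIntegral_congr_fun measurableSet_Ioi fun t ht => ?_
  simp only [map_smul]
  rw [add_comm t h, hT.semigroup h t hh ht, smul_smul, ← Real.exp_add, ContinuousLinearMap.comp_apply]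
  congr 2
  ring

/-- Shifting the integration variable gives `(u - T h u) / h = h⁻¹ (1 - e^{αh}) u + e^{αh} h⁻¹ ∫₀^h
e^{-αt} T t f dt`, which tends to `-α u + f`. -/
theorem isLD_laplace (hT : Γ.IsSemigroupQD T) {α : ℝ} (hα : 0 < α) (f : EllTwo V) :
    Γ.IsLD (∫ t in Set.Ioi 0, Real.exp (-α * t) • T t f)
      (f - α • ∫ t in Set.Ioi 0, Real.exp (-α * t) • T t f) := by
  rw [hT.generator]
  set u := ∫ t in Set.Ioi 0, Real.exp (-α * t) • T t f with hu
  have h1 : Tendsto (fun h : ℝ => h⁻¹ * (1 - Real.exp (α * h))) (𝓝[>] 0) (𝓝 (-α)) := by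
    have h2 : HasDerivAt (fun h : ℝ => Real.exp (α * h)) α 0 := by
      simpa using ((hasDerivAt_id (0 : ℝ)).const_mul α).exp
    have h3 := (hasDerivAt_iff_tendsto_slope_zero.1 h2).neg
    refine (h3.mono_left (nhdsWithin_mono _ fun x hx => ne_of_gt hx)).congr fun h => ?_
    simp
    ring
  have h2 : Tendsto (fun h : ℝ => Real.exp (α * h)) (𝓝[>] 0) (𝓝 1) :=
    tendsto_nhdsWithin_of_tendsto_nhds (Continuous.tendsto' (by fun_prop) _ _ (by simp))
  have h3 := (h1.smul_const u).add (h2.smul (hT.tendsto_average hα f))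
  rw [one_smul, neg_smul, neg_add_eq_sub] at h3
  refine h3.congr' ?_
  filter_upwards [self_mem_nhdsWithin] with h hh
  rw [hu, hT.apply_laplace hα f hh]
  module

/-- Every semigroup satisfying the axioms has the same Laplace transform, so the Green function does
not depend on its choice. -/
theorem laplace_eq_resolvent (hT : Γ.IsSemigroupQD T) {α : ℝ} (hα : 0 < α) (f : EllTwo V) :
    ∫ t in Set.Ioi 0, Real.exp (-α * t) • T t f = Γ.resolvent α⁻¹ (α⁻¹ • f) := by
  have h := (isLD_iff_resolvent (inv_pos.2 hα) _ _).1 (hT.isLD_laplace hα f)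
  rwa [smul_sub, inv_smul_smul₀ hα.ne', add_sub_cancel, eq_comm] at h

theorem apply_deltaFun_nonneg (hT : Γ.IsSemigroupQD T) {t : ℝ} (ht : 0 < t) (x y : V) :
    0 ≤ T t (deltaFun x) y := by
  classical
  refine (hT.markov t ht (deltaFun x) (fun z => ?_) y).1
  rw [deltaFun_apply]
  split_ifs <;> simp

theorem lintegral_laplace (hT : Γ.IsSemigroupQD T) {α : ℝ} (hα : 0 < α) (x y : V) :
    ∫⁻ t in Set.Ioi (0 : ℝ), ENNReal.ofReal (Real.exp (-α * t) * T t (deltaFun x) y) =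
      ENNReal.ofReal (Γ.resolvent α⁻¹ (α⁻¹ • deltaFun x) y) := by
  have hint := hT.integrableOn_laplace hα (deltaFun x)
  have h1 := ContinuousLinearMap.integral_comp_comm (lp.evalCLM ℝ (fun _ : V => ℝ) 2 y) hint
  rw [hT.laplace_eq_resolvent hα] at h1
  have h2 := (lp.evalCLM ℝ (fun _ : V => ℝ) 2 y).integrable_comp hint
  change _ = Γ.resolvent α⁻¹ (α⁻¹ • deltaFun x) y at h1
  rw [← h1, ofReal_integral_eq_lintegral_ofReal h2]
  · rfl
  · refine (ae_restrict_mem measurableSet_Ioi).mono fun t ht => ?_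
    exact mul_nonneg (Real.exp_nonneg _) (hT.apply_deltaFun_nonneg ht x y)

/-- Monotone convergence in the Laplace transform as `α = 1 / (k + 1)` decreases to `0`. -/
theorem tendsto_resolvent_green (hT : Γ.IsSemigroupQD T) (x y : V) :
    Tendsto (fun k : ℕ => ENNReal.ofReal
      (Γ.resolvent (1 / ((k : ℝ) + 1))⁻¹ ((1 / ((k : ℝ) + 1))⁻¹ • deltaFun x) y)) atTop
      (𝓝 (green T x y)) := by
  have h0 : ∀ k : ℕ, (0 : ℝ) < 1 / ((k : ℝ) + 1) := fun k => Nat.one_div_pos_of_nat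
  simp_rw [← fun k => hT.lintegral_laplace (h0 k) x y]
  refine lintegral_tendsto_of_tendsto_of_monotone (fun k => ?_) ?_ ?_
  · have hint := hT.integrableOn_laplace (h0 k) (deltaFun x)
    have h2 := (lp.evalCLM ℝ (fun _ : V => ℝ) 2 y).integrable_comp hint
    exact h2.aestronglyMeasurable.aemeasurable.ennreal_ofReal
  · refine (ae_restrict_mem measurableSet_Ioi).mono fun t ht k l hkl => ?_
    have ht0 : 0 < t := ht
    refine ENNReal.ofReal_le_ofReal (mul_le_mul_of_nonneg_right (Real.exp_le_exp.2 ?_)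
      (hT.apply_deltaFun_nonneg ht x y))
    rw [neg_mul, neg_mul, neg_le_neg_iff]
    exact mul_le_mul_of_nonneg_right (Nat.one_div_le_one_div hkl) ht0.le
  · refine .of_forall fun t => ENNReal.tendsto_ofReal ?_
    have h1 := (tendsto_one_div_add_atTop_nhds_zero_nat (𝕜 := ℝ)).neg.mul_const t
    simpa using ((Real.continuous_exp.tendsto _).comp h1).mul_const (T t (deltaFun x) y)

/-- The Green function satisfies the Green inequality. -/
theorem green_superharmonic [DecidableEq V] (hT : Γ.IsSemigroupQD T) (hdeg : ∀ y, 0 < Γ.deg y)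
    (x y : V) : (if y = x then 1 else 0) + ∑' z, ENNReal.ofReal (Γ.b y z) * green T x z ≤
      ENNReal.ofReal (Γ.deg y) * green T x y := by
  -- Only finite partial sums pass to the limit `α → 0` term by term, and an inequality is all that
  -- is needed.
  rw [ENNReal.tsum_eq_iSup_sum, ENNReal.add_iSup]
  refine iSup_le fun F => ?_
  have h0 : ∀ k : ℕ, (0 : ℝ) < 1 / ((k : ℝ) + 1) := fun k => Nat.one_div_pos_of_nat
  set U : ℕ → EllTwo V := fun k =>
    Γ.resolvent (1 / ((k : ℝ) + 1))⁻¹ ((1 / ((k : ℝ) + 1))⁻¹ • deltaFun x) with hU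
  have hU0 : ∀ k z, 0 ≤ U k z := fun k z => by
    refine resolvent_nonneg (inv_pos.2 (h0 k)) (fun w => ?_) z
    rw [lp.coeFn_smul, Pi.smul_apply, smul_eq_mul, deltaFun_apply]
    have := (inv_pos.2 (h0 k)).le
    split_ifs
    · simpa using this
    · simp
  have hlim : ∀ z, Tendsto (fun k => ENNReal.ofReal (U k z)) atTop (𝓝 (green T x z)) :=
    fun z => hT.tendsto_resolvent_green x z
  have h1 : Tendsto (fun k : ℕ => (if y = x then 1 else 0) +
      ∑ z ∈ F, ENNReal.ofReal (Γ.b y z) * ENNReal.ofReal (U k z)) atTop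
      (𝓝 ((if y = x then 1 else 0) + ∑ z ∈ F, ENNReal.ofReal (Γ.b y z) * green T x z)) :=
    (tendsto_finsetSum _ fun z _ =>
      ENNReal.Tendsto.const_mul (hlim z) (.inr ENNReal.ofReal_ne_top)).const_add _
  have h2 : Tendsto (fun k : ℕ => ENNReal.ofReal (Γ.deg y + 1 / ((k : ℝ) + 1)) *
      ENNReal.ofReal (U k y)) atTop (𝓝 (ENNReal.ofReal (Γ.deg y) * green T x y)) := by
    refine ENNReal.Tendsto.mul ?_ (.inl (by simpa using hdeg y)) (hlim y)
      (.inr ENNReal.ofReal_ne_top)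
    refine ENNReal.tendsto_ofReal ?_
    simpa using (tendsto_one_div_add_atTop_nhds_zero_nat (𝕜 := ℝ)).const_add (Γ.deg y)
  refine le_of_tendsto_of_tendsto' h1 h2 fun k => ?_
  have h3 : Γ.IsLD (U k) (deltaFun x - (1 / ((k : ℝ) + 1)) • U k) := by
    have := hT.isLD_laplace (h0 k) (deltaFun x)
    rwa [hT.laplace_eq_resolvent (h0 k)] at this
  obtain ⟨w, hw, hwy⟩ := exists_mem_formDomain_deltaFun (Γ := Γ) zero_le_one y
  have h4 := h3.2 (deltaFun y) ((mem_domQD_iff one_pos _).2 ⟨w, hw, hwy⟩)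
  rw [form_deltaFun, inner_deltaFun_right] at h4
  have h5 : (Γ.deg y + 1 / ((k : ℝ) + 1)) * U k y = deltaFun x y + ∑' z, Γ.b y z * U k z := by
    simp only [lp.coeFn_sub, lp.coeFn_smul, Pi.sub_apply, Pi.smul_apply, smul_eq_mul] at h4
    linarith
  have h6 : ∀ z, 0 ≤ Γ.b y z * U k z := fun z => mul_nonneg (Γ.b_nonneg _ _) (hU0 k z)
  rw [← ENNReal.ofReal_mul (add_pos (hdeg y) (h0 k)).le, h5, ENNReal.ofReal_add _ (tsum_nonneg h6),
    ENNReal.ofReal_tsum_of_nonneg h6 (summable_b_mul _ _), ofReal_deltaFun]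
  · gcongr
    simp_rw [← ENNReal.ofReal_mul (Γ.b_nonneg _ _)]
    exact ENNReal.sum_le_tsum F
  · rw [deltaFun_apply]
    split_ifs <;> simp

/-- The Green function is the sum of its Neumann series. -/
theorem green_eq (hT : Γ.IsSemigroupQD T) (hdeg : ∀ y, 0 < Γ.deg y) (x y : V) :
    green T x y = ⨆ N, Γ.greenIter x N y := by
  classical
  refine le_antisymm ?_ (iSup_le fun N => ?_)
  · exact le_of_tendsto' (hT.tendsto_resolvent_green x y) fun k =>
      ofReal_resolvent_deltaFun_le Nat.one_div_pos_of_nat hdeg x y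
  · induction N generalizing y with
    | zero => exact zero_le
    | succ N ih =>
      rw [greenIter]
      refine ENNReal.div_le_of_le_mul' (le_trans ?_ (hT.green_superharmonic hdeg x y))
      gcongr with z
      exact ih z

end IsSemigroupQD

end WeightedGraph

/-! ### Symmetry and spreading of the Green function; the walk -/

namespace WeightedGraph

variable {V : Type*} {Γ : WeightedGraph V}

theorem Connected.deg_pos [Nontrivial V] (hΓ : Γ.Connected) (x : V) : 0 < Γ.deg x := by
  obtain ⟨y, hy⟩ := exists_ne x
  rcases (hΓ x y).cases_head with h | ⟨z, hz, -⟩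
  · exact absurd h hy.symm
  · exact lt_of_lt_of_le hz ((Γ.b_summable x).le_tsum z fun w _ => Γ.b_nonneg x w)

theorem IsSemigroupQD.green_symm {T : ℝ → EllTwo V →L[ℝ] EllTwo V} (hT : Γ.IsSemigroupQD T)
    (x y : V) : green T x y = green T y x := by
  refine setLIntegral_congr_fun measurableSet_Ioi fun t ht => ?_
  have h := (ContinuousLinearMap.isSelfAdjoint_iff_isSymmetric.1 (hT.symmetric t ht))
    (deltaFun x) (deltaFun y)
  change inner ℝ (T t (deltaFun x)) (deltaFun y) = inner ℝ (deltaFun x) (T t (deltaFun y)) at h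
  rw [inner_deltaFun_right, real_inner_comm, inner_deltaFun_right] at h
  simp only [h]

/-- On a connected graph, an infinite value of the Green function spreads. -/
theorem IsSemigroupQD.green_eq_top (hΓ : Γ.Connected) (hdeg : ∀ y, 0 < Γ.deg y)
    {T : ℝ → EllTwo V →L[ℝ] EllTwo V} (hT : Γ.IsSemigroupQD T) {x z : V} (h : green T x z = ∞)
    (y : V) : green T x y = ∞ := by
  classical
  induction hΓ y z using Relation.ReflTransGen.head_induction_on with
  | refl => exact h
  | @head a c hab _ ih =>
    -- Superharmonicity at `a` gives `b a c * G(x, c) ≤ deg a * G(x, a)`, so the value `∞` passes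
    -- from `c` to its neighbour `a`.
    have h1 := (le_add_self.trans (hT.green_superharmonic hdeg x a))
    have h2 := (ENNReal.le_tsum (f := fun z => ENNReal.ofReal (Γ.b a z) * green T x z) c).trans h1
    have hb : ENNReal.ofReal (Γ.b a c) ≠ 0 := by simpa using show 0 < Γ.b a c from hab
    rw [ih, ENNReal.mul_top hb, top_le_iff] at h2
    by_contra hne
    exact ENNReal.mul_ne_top ENNReal.ofReal_ne_top hne h2

/-! ### The random walk -/

/-- The event `E` only depends on `X 0, …, X n`. -/
def DependsOnPast {Ω : Type*} (X : ℕ → Ω → V) (n : ℕ) (E : Set Ω) : Prop :=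
  ∀ ω ω', (∀ k ≤ n, X k ω = X k ω') → ω ∈ E → ω' ∈ E

theorem DependsOnPast.inter_setOf_eq {Ω : Type*} {X : ℕ → Ω → V} {n : ℕ} {E : Set Ω}
    (hE : DependsOnPast X n E) (z : V) :
    DependsOnPast X (n + 1) (E ∩ {ω | X n ω = z}) := fun ω ω' h hω =>
  ⟨hE ω ω' (fun k hk => h k (hk.trans n.le_succ)) hω.1, (h n n.le_succ).symm.trans hω.2⟩

theorem dependsOnPast_setOf_zero {Ω : Type*} (X : ℕ → Ω → V) (n : ℕ) (x : V) :
    DependsOnPast X n {ω | X 0 ω = x} := fun _ _ h hω => (h 0 n.zero_le).symm.trans hω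

variable (Γ) in
/-- Transition probabilities of the random walk. -/
noncomputable def transProb (x y : V) : ℝ≥0∞ := ENNReal.ofReal (Γ.b x y / Γ.deg x)

theorem transProb_le_one (x y : V) : Γ.transProb x y ≤ 1 := by
  rw [transProb, ENNReal.ofReal_le_one]
  exact div_le_one_of_le₀ ((Γ.b_summable x).le_tsum y fun w _ => Γ.b_nonneg x w) (deg_nonneg x)

open Classical in
/-- The probability that the walk started in `z` does not visit `y` in the steps `1, …, N`. -/
noncomputable def avoidProb (Γ : WeightedGraph V) (y : V) : ℕ → V → ℝ≥0∞
  | 0, _ => 1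
  | N + 1, z => ∑' w, Γ.transProb z w * if w = y then 0 else Γ.avoidProb y N w

/-- One way to avoid `y` forever from `z` is to step to `w ≠ y` and avoid it from there. -/
theorem transProb_mul_iInf_avoidProb_le {y z w : V} (hw : w ≠ y) :
    Γ.transProb z w * ⨅ N, Γ.avoidProb y N w ≤ ⨅ N, Γ.avoidProb y N z := by
  refine le_iInf fun N => ?_
  cases N with
  | zero => exact mul_le_one' (transProb_le_one z w) (iInf_le (fun N => Γ.avoidProb y N w) 0)
  | succ N =>
    rw [avoidProb]
    refine le_trans ?_ (ENNReal.le_tsum w)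
    rw [if_neg hw]
    gcongr
    exact iInf_le (fun N => Γ.avoidProb y N w) N

/-- Along a path from `y`, certainty of hitting `y` passes from `a` to each neighbour `c`: an escape
from `c` would yield an escape from `a`. If the path meets `y` again, the hypothesis applies afresh.
-/
theorem iInf_avoidProb_eq_zero (hΓ : Γ.Connected) (hdeg : ∀ y, 0 < Γ.deg y) {y : V}
    (h : ⨅ N, Γ.avoidProb y N y = 0) (z : V) : ⨅ N, Γ.avoidProb y N z = 0 := by
  induction hΓ y z with
  | refl => exact h
  | @tail a c _ hab ih =>
    by_cases hc : c = y
    · rw [hc, h]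
    have h1 := transProb_mul_iInf_avoidProb_le (Γ := Γ) (z := a) hc
    rw [ih, nonpos_iff_eq_zero, mul_eq_zero] at h1
    refine h1.resolve_left ?_
    rw [transProb, ENNReal.ofReal_eq_zero, not_le]
    exact div_pos hab (hdeg a)

section RandomWalkLaw

variable [MeasurableSpace V] {Ω : Type*} [MeasurableSpace Ω] {P : Measure Ω} {X : ℕ → Ω → V}

theorem measure_eq_tsum_inter [Countable V] [MeasurableSingletonClass V] (P : Measure Ω)
    {Y : Ω → V} (hY : Measurable Y) (F : Set Ω) : P F = ∑' z, P (F ∩ {ω | Y ω = z}) := by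
  have h := tsum_measure_preimage_singleton (μ := P.restrict F) (Set.countable_univ (α := V))
    (f := Y) fun z _ => hY (measurableSet_singleton z)
  rw [Set.preimage_univ, Measure.restrict_apply_univ, tsum_univ
    (fun z => (P.restrict F) (Y ⁻¹' {z}))] at h
  rw [← h]
  refine tsum_congr fun z => ?_
  rw [Measure.restrict_apply (hY (measurableSet_singleton z)), Set.inter_comm]
  rfl

namespace IsRandomWalk

variable [MeasurableSingletonClass V]

theorem measurableSet_eq (hX : Γ.IsRandomWalk P X) (n : ℕ) (z : V) :
    MeasurableSet {ω | X n ω = z} :=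
  hX.measurable n (measurableSet_singleton z)

theorem measure_path_inter [IsProbabilityMeasure P] (hX : Γ.IsRandomWalk P X) (n : ℕ) (x : ℕ → V)
    (w : V) : P ({ω | ∀ k ≤ n, X k ω = x k} ∩ {ω | X (n + 1) ω = w}) =
      P {ω | ∀ k ≤ n, X k ω = x k} * Γ.transProb (x n) w := by
  classical
  by_cases h0 : P {ω | ∀ k ≤ n, X k ω = x k} = 0
  · rw [h0, zero_mul]
    exact measure_mono_null Set.inter_subset_left h0
  have hm : MeasurableSet {ω | ∀ k ≤ n, X k ω = x k} := by
    simp only [Set.ofPred_forall]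
    exact MeasurableSet.iInter fun k => MeasurableSet.iInter fun _ => hX.measurableSet_eq k (x k)
  have h1 : P {ω | X n ω = x n} ≠ 0 := fun h =>
    h0 (measure_mono_null (fun ω hω => hω n le_rfl) h)
  -- The Markov hypothesis reads the next state from the path itself, so entry `n + 1` is replaced
  -- by `w`.
  have h2 := hX.markov n (Function.update x (n + 1) w)
  have h3 : ∀ k ≤ n, Function.update x (n + 1) w k = x k := fun k hk =>
    Function.update_of_ne (by omega) _ _
  have h4 : {ω | ∀ k ≤ n, X k ω = Function.update x (n + 1) w k} = {ω | ∀ k ≤ n, X k ω = x k} :=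
    Set.ext fun ω => forall₂_congr fun k hk => by rw [h3 k hk]
  rw [h4, Function.update_self, h3 n le_rfl] at h2
  have h5 := h2 h0
  rw [hX.transition n (x n) w h1, cond_apply hm] at h5
  rw [transProb, ← h5, ← mul_assoc, ENNReal.mul_inv_cancel h0 (measure_ne_top _ _), one_mul]

variable [Countable V] [IsProbabilityMeasure P]

/-- The Markov property at time `n` with respect to the whole past. -/
theorem measure_inter_step (hX : Γ.IsRandomWalk P X) {n : ℕ} {E : Set Ω}
    (hE : DependsOnPast X n E) (z w : V) :
    P (E ∩ {ω | X n ω = z} ∩ {ω | X (n + 1) ω = w}) =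
      P (E ∩ {ω | X n ω = z}) * Γ.transProb z w := by
  -- The past event is the preimage of a countable set of finite paths, so it splits into path
  -- events and its measurability need not be assumed.
  let φ : Ω → Fin (n + 1) → V := fun ω i => X i ω
  have hφ : Measurable φ := measurable_pi_lambda _ fun i => hX.measurable i
  set s := φ '' (E ∩ {ω | X n ω = z}) with hs
  have hpre : φ ⁻¹' s = E ∩ {ω | X n ω = z} := by
    refine Set.Subset.antisymm ?_ (Set.subset_preimage_image _ _)
    rintro ω ⟨ω', ⟨h1, h2⟩, h3⟩
    have h4 : ∀ k ≤ n, X k ω' = X k ω := fun k hk => congrFun h3 ⟨k, Nat.lt_succ_of_le hk⟩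
    exact ⟨hE ω' ω h4 h1, (h4 n le_rfl).symm.trans h2⟩
  have hcount : s.Countable := Set.to_countable s
  have hm : ∀ a ∈ s, MeasurableSet (φ ⁻¹' {a}) := fun a _ => hφ (measurableSet_singleton a)
  have h1 := tsum_measure_preimage_singleton (μ := P) hcount hm
  have h2 := tsum_measure_preimage_singleton (μ := P.restrict {ω | X (n + 1) ω = w}) hcount hm
  rw [hpre] at h1 h2
  rw [Measure.restrict_apply (hpre ▸ hφ hcount.measurableSet)] at h2
  rw [← h2, ← h1, ← ENNReal.tsum_mul_right]
  refine tsum_congr fun a => ?_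
  obtain ⟨ω₀, hω₀, ha⟩ := a.2
  have h3 : φ ⁻¹' {(a : Fin (n + 1) → V)} = {ω | ∀ k ≤ n, X k ω = X k ω₀} := by
    ext ω
    rw [← ha]
    constructor
    · intro h k hk
      exact congrFun h ⟨k, Nat.lt_succ_of_le hk⟩
    · intro h
      exact funext fun i => h i (Nat.le_of_lt_succ i.2)
  rw [Measure.restrict_apply (hm a a.2), h3, hX.measure_path_inter n (fun k => X k ω₀) w, hω₀.2]

/-- Induction by conditioning on `X (n + 1)`; the event `X n = z` joins the past, which is why `E`
and `n` are general. -/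
theorem measure_avoid (hX : Γ.IsRandomWalk P X) (y : V) (N : ℕ) {n : ℕ} {E : Set Ω}
    (hE : DependsOnPast X n E) (z : V) :
    P (E ∩ {ω | X n ω = z} ∩ {ω | ∀ j, n < j → j ≤ n + N → X j ω ≠ y}) =
      P (E ∩ {ω | X n ω = z}) * Γ.avoidProb y N z := by
  induction N generalizing n E z with
  | zero =>
    rw [avoidProb, mul_one]
    congr 1
    refine Set.inter_eq_left.2 fun ω _ j h1 h2 => ?_
    omega
  | succ N ih =>
    rw [measure_eq_tsum_inter P (hX.measurable (n + 1)), avoidProb, ← ENNReal.tsum_mul_left]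
    refine tsum_congr fun w => ?_
    by_cases hw : w = y
    · rw [if_pos hw, mul_zero, mul_zero]
      refine measure_mono_null (t := ∅) ?_ measure_empty
      rintro ω ⟨⟨-, h1⟩, h2⟩
      exact h1 (n + 1) n.lt_succ_self (by omega) (hw ▸ h2)
    · rw [if_neg hw, ← mul_assoc, ← hX.measure_inter_step hE z w, ← ih (hE.inter_setOf_eq z)]
      congr 1
      ext ω
      constructor
      · rintro ⟨⟨h1, h2⟩, h3⟩
        exact ⟨⟨h1, h3⟩, fun j hj hj' => h2 j (by omega) (by omega)⟩
      · rintro ⟨⟨h1, h3⟩, h2⟩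
        refine ⟨⟨h1, fun j hj hj' => ?_⟩, h3⟩
        rcases Nat.eq_or_lt_of_le (Nat.succ_le_of_lt hj) with h | h
        · rw [← h]
          exact fun h' => hw (h3.symm.trans h')
        · exact h2 j h (by omega)

/-- The expected number of visits in terms of the Green function. -/
theorem tsum_measure_eq (hX : Γ.IsRandomWalk P X) (hdeg : ∀ y, 0 < Γ.deg y) (x y : V) :
    ∑' n, P ({ω | X 0 ω = x} ∩ {ω | X n ω = y}) =
      P {ω | X 0 ω = x} * (ENNReal.ofReal (Γ.deg y) * ⨆ N, Γ.greenIter x N y) := by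
  classical
  have hd0 : ∀ z, ENNReal.ofReal (Γ.deg z) ≠ 0 := fun z => by simpa using hdeg z
  have key : ∀ N y, ∑ n ∈ Finset.range N, P ({ω | X 0 ω = x} ∩ {ω | X n ω = y}) =
      P {ω | X 0 ω = x} * (ENNReal.ofReal (Γ.deg y) * Γ.greenIter x N y) := by
    intro N
    induction N with
    | zero => intro y; simp [greenIter]
    | succ N ih =>
      intro y
      have h0 : P ({ω | X 0 ω = x} ∩ {ω | X 0 ω = y}) =
          P {ω | X 0 ω = x} * if y = x then 1 else 0 := by
        split_ifs with h
        · rw [h, Set.inter_self, mul_one]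
        · rw [mul_zero]
          refine measure_mono_null (t := ∅) ?_ measure_empty
          rintro ω ⟨h1, h2⟩
          exact h (h2.symm.trans h1)
      have hstep : ∀ n, P ({ω | X 0 ω = x} ∩ {ω | X (n + 1) ω = y}) =
          ∑' z, P ({ω | X 0 ω = x} ∩ {ω | X n ω = z}) * Γ.transProb z y := by
        intro n
        rw [measure_eq_tsum_inter P (hX.measurable n)]
        refine tsum_congr fun z => ?_
        rw [Set.inter_right_comm,
          hX.measure_inter_step (dependsOnPast_setOf_zero X n x) z y]
      rw [Finset.sum_range_succ', h0, greenIter, ENNReal.mul_div_cancel (hd0 y)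
        ENNReal.ofReal_ne_top, mul_add, add_comm, ← ENNReal.tsum_mul_left]
      congr 1
      simp_rw [hstep]
      rw [← Summable.tsum_finsetSum fun _ _ => ENNReal.summable]
      refine tsum_congr fun z => ?_
      -- Reversibility: the factor `deg z` from the induction hypothesis cancels the denominator of
      -- the transition probability from `z` to `y`, and `b z y = b y z` produces the recursion of
      -- `greenIter` at `y`.
      rw [← Finset.sum_mul, ih z, transProb, ENNReal.ofReal_div_of_pos (hdeg z), Γ.b_symm z y,
        mul_assoc, mul_right_comm, ENNReal.mul_div_cancel (hd0 z) ENNReal.ofReal_ne_top]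
  rw [ENNReal.tsum_eq_iSup_nat, ENNReal.mul_iSup, ENNReal.mul_iSup]
  exact iSup_congr fun N => key N y

/-- If the expected number of visits is infinite, then the return to `y` is certain. -/
theorem iInf_avoidProb_self (hX : Γ.IsRandomWalk P X) {x y : V}
    (h : ∑' n, P ({ω | X 0 ω = x} ∩ {ω | X n ω = y}) = ∞) : ⨅ N, Γ.avoidProb y N y = 0 := by
  by_contra hne
  suffices h1 : (∑' n, P ({ω | X 0 ω = x} ∩ {ω | X n ω = y})) * ⨅ N, Γ.avoidProb y N y ≤ 1 by
    rw [h, ENNReal.top_mul hne] at h1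
    exact absurd h1 (by simp)
  rw [ENNReal.tsum_eq_iSup_nat, ENNReal.iSup_mul]
  refine iSup_le fun M => ?_
  -- `B n` says that the last visit to `y` up to time `M` occurs at time `n`; for `n < M` these
  -- events are disjoint and their probabilities sum to at most `1`.
  set B : ℕ → Set Ω := fun n => {ω | X 0 ω = x} ∩ {ω | X n ω = y} ∩
    {ω | ∀ j, n < j → j ≤ n + (M - n) → X j ω ≠ y}
  have hB : ∀ n, MeasurableSet (B n) := fun n => by
    refine ((hX.measurableSet_eq 0 x).inter (hX.measurableSet_eq n y)).inter ?_
    simp only [Set.ofPred_forall]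
    exact MeasurableSet.iInter fun j => MeasurableSet.iInter fun _ => MeasurableSet.iInter fun _ =>
      (hX.measurableSet_eq j y).compl
  have hdisj : (Finset.range M : Set ℕ).PairwiseDisjoint B := by
    have hlt : ∀ m n, m < n → n < M → Disjoint (B m) (B n) := fun m n hmn hn => by
      refine Set.disjoint_left.2 fun ω hm hn' => ?_
      exact hm.2 n hmn (by omega) hn'.1.2
    intro m hm n hn hmn
    simp only [Finset.coe_range, Set.mem_Iio] at hm hn
    rcases lt_or_gt_of_ne hmn with h | h
    · exact hlt m n h hn
    · exact (hlt n m h hm).symm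
  calc (∑ n ∈ Finset.range M, P ({ω | X 0 ω = x} ∩ {ω | X n ω = y})) * ⨅ N, Γ.avoidProb y N y
      ≤ ∑ n ∈ Finset.range M, P (B n) := by
        rw [Finset.sum_mul]
        refine Finset.sum_le_sum fun n _ => ?_
        rw [hX.measure_avoid y (M - n) (dependsOnPast_setOf_zero X n x) y]
        gcongr
        exact iInf_le (fun N => Γ.avoidProb y N y) _
    _ = P (⋃ n ∈ Finset.range M, B n) :=
        (measure_biUnion_finset hdisj fun n _ => hB n).symm
    _ ≤ 1 := prob_le_one

theorem isRecurrentProcess_iff (hX : Γ.IsRandomWalk P X) (hΓ : Γ.Connected)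
    (hdeg : ∀ y, 0 < Γ.deg y) : IsRecurrentProcess P X ↔
      ∀ x y, P {ω | X 0 ω = x} ≠ 0 → ⨆ N, Γ.greenIter x N y = ∞ := by
  have hvisits : ∀ x y, P {ω | X 0 ω = x} ≠ 0 →
      (∑' n, P ({ω | X 0 ω = x} ∩ {ω | X n ω = y}) = ∞ ↔ ⨆ N, Γ.greenIter x N y = ∞) := by
    intro x y hx
    have hd0 : ENNReal.ofReal (Γ.deg y) ≠ 0 := by simpa using hdeg y
    rw [hX.tsum_measure_eq hdeg]
    constructor
    · intro h
      by_contra hne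
      exact ENNReal.mul_ne_top (measure_ne_top _ _)
        (ENNReal.mul_ne_top ENNReal.ofReal_ne_top hne) h
    · intro h
      rw [h, ENNReal.mul_top hd0, ENNReal.mul_top hx]
  refine forall₂_congr fun x y => forall_congr' fun hx => ?_
  rw [← hvisits x y hx, cond_apply (hX.measurableSet_eq 0 x)]
  constructor
  · intro h
    by_contra hne
    -- Borel–Cantelli: finitely many expected visits exclude infinitely many visits almost surely.
    have h1 := measure_setOfPred_frequently_eq_zero (μ := P)
      (p := fun n ω => X 0 ω = x ∧ X n ω = y) hne
    have h2 : P ({ω | X 0 ω = x} ∩ {ω | ∃ᶠ n in atTop, X n ω = y}) = 0 :=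
      measure_mono_null (fun ω hω => hω.2.mono fun n hn => ⟨hω.1, hn⟩) h1
    rw [h2, mul_zero] at h
    exact zero_ne_one h
  · intro h
    have hq := iInf_avoidProb_eq_zero hΓ hdeg (hX.iInf_avoidProb_self h)
    have h1 : P ({ω | X 0 ω = x} \ {ω | ∃ᶠ n in atTop, X n ω = y}) = 0 := by
      -- If `y` is visited only finitely often, it is avoided after some time `n` from the position
      -- `z = X n`; there are countably many such null events.
      have h2 : ∀ n z, P ({ω | X 0 ω = x} ∩ {ω | X n ω = z} ∩ {ω | ∀ j, n < j → X j ω ≠ y}) = 0 := by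
        intro n z
        rw [← nonpos_iff_eq_zero, ← hq z]
        refine le_iInf fun N => ?_
        calc _ ≤ P ({ω | X 0 ω = x} ∩ {ω | X n ω = z} ∩
              {ω | ∀ j, n < j → j ≤ n + N → X j ω ≠ y}) :=
              measure_mono fun ω hω => ⟨hω.1, fun j hj _ => hω.2 j hj⟩
          _ = _ := hX.measure_avoid y N (dependsOnPast_setOf_zero X n x) z
          _ ≤ _ := mul_le_of_le_one_left' prob_le_one
      refine measure_mono_null ?_ (measure_iUnion_null fun n => measure_iUnion_null (h2 n))
      rintro ω ⟨hω, hio⟩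
      obtain ⟨n, hn⟩ := eventually_atTop.1 (not_frequently.1 hio)
      exact Set.mem_iUnion₂.2 ⟨n, X n ω, ⟨hω, rfl⟩, fun j hj => hn j hj.le⟩
    have h3 : P ({ω | X 0 ω = x} ∩ {ω | ∃ᶠ n in atTop, X n ω = y}) = P {ω | X 0 ω = x} := by
      refine le_antisymm (measure_mono Set.inter_subset_left) ?_
      have h4 := measure_le_inter_add_sdiff P {ω | X 0 ω = x} {ω | ∃ᶠ n in atTop, X n ω = y}
      rwa [h1, add_zero] at h4
    rw [h3, ENNReal.inv_mul_cancel hx (measure_ne_top _ _)]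

end IsRandomWalk

end RandomWalkLaw

end WeightedGraph

/-! ### The main theorem -/

theorem mainTheorem2 {V : Type*} [Countable V] [Infinite V]
    [MeasurableSpace V] [MeasurableSingletonClass V]
    (Γ : WeightedGraph V) (hΓ : Γ.Connected)
    {Ω : Type*} [MeasurableSpace Ω] (P : Measure Ω) [IsProbabilityMeasure P]
    (X : ℕ → Ω → V) (hX : Γ.IsRandomWalk P X) :
    IsRecurrentProcess P X ↔ Γ.IsRecurrentQD := by
  have hdeg := hΓ.deg_pos
  rw [hX.isRecurrentProcess_iff hΓ hdeg]
  constructor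
  · intro h
    obtain ⟨T, hT⟩ := WeightedGraph.exists_isSemigroupQD (Γ := Γ)
    -- Recurrence of the walk says something only about starting points that the initial law
    -- charges; at least one exists since `V` is countable.
    obtain ⟨x₀, hx₀⟩ : ∃ x, P {ω | X 0 ω = x} ≠ 0 := by
      by_contra! h0
      have h1 := WeightedGraph.measure_eq_tsum_inter P (hX.measurable 0) Set.univ
      simp [h0] at h1
    -- The walk gives `G(x₀, x) = ∞`; symmetry gives `G(x, x₀) = ∞`, and connectedness spreads this
    -- to `G(x, y)`.
    refine ⟨T, hT, fun x y => hT.green_eq_top hΓ hdeg (z := x₀) ?_ y⟩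
    rw [hT.green_symm, hT.green_eq hdeg]
    exact h x₀ x hx₀
  · rintro ⟨T, hT, h⟩ x y -
    rw [← hT.green_eq hdeg]
    exact h x y
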